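/- **Theorem 1.3.** Paths are finite (a single vertex is a path) and rays are one-way infinite paths; the vertices of a path or ray are distinct, and in a digraph both are directed. Let $B$ be a set of vertices. A ray $R$ *dominates* $B$ if there are infinitely many vertex-disjoint paths from $R$ to $B$. A vertex $v$ *dominates* $B$ if there are infinitely many paths from $v$ to $B$ that are vertex-disjoint except in $v$. A path *dominates* $B$ if its last vertex does. A *domination linkage* from $A$ to $B$ is a family $(Q_a\mid a\in A)$ of pairwise vertex-disjoint paths or rays such that each $Q_a$ starts in $a$ and either ends in a vertex of $B$ or dominates $B$. A set $S$ of vertices *can be linked to* $B$ if there is a family $(P_s\mid s\in S)$ of pairwise vertex-disjoint paths such that $P_s$ starts in $s$ and ends in $B$. (i) Let $G$ be a digraph, finite or infinite, and $A,B\subseteq V(G)$. There is a domination linkage from $A$ to $B$ if and only if every finite subset of $A$ can be linked to $B$. (ii) Let $G$ be an undirected graph, finite or infinite, and $A,B\subseteq V(G)$. Let $\Omega$ be the set of ends of $G$, that is, of the equivalence classes of rays, where two rays are equivalent if for every finite set $X$ of vertices they have tails in the same component of $G-X$. Consider on $V(G)\cup\Omega$ the topology generated by the following sets: for every finite $X\subseteq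 V(G)$ and every component $C$ of $G-X$, the set of all vertices of $C$ together with all ends that have a ray in $C$. In this topology the closure $\overline B$ of $B$ consists of $B$, the vertices dominating $B$, and the ends $\omega$ all of whose rays dominate $B$. The following statements are equivalent: * $A$ can be linked to $\overline B$ by vertex-disjoint paths and rays: there is a family $(Q_a\mid a\in A)$ of pairwise vertex-disjoint paths or rays such that $Q_a$ starts in $a$ and is either a path whose last vertex lies in $\overline B$ or a ray whose end lies in $\overline B$; * there is a domination linkage from $A$ to $B$ (formed with undirected paths and rays); * every finite subset of $A$ can be linked to $B$ (by undirected paths). -/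

import Mathlib

open Filter

universe u

namespace DomLink

variable {V : Type u}

/-! Paths and rays. Everything is defined for an arbitrary adjacency relation `r`. For a digraph
`r` is `G.Adj`, and paths and rays are directed; for an undirected graph `r` is the symmetric
relation `G.Adj`, and paths and rays are the usual undirected ones. -/

/-- A (finite) path, given by its nonempty sequence of pairwise distinct vertices. A single vertex
is a (trivial) path. -/
@[ext]
structure FinPath (r : V → V → Prop) where
  verts : List V
  ne_nil : verts ≠ []
  chain : verts.IsChain r
  nodup : verts.Nodup

/-- A ray: a one-way infinite path, given by its sequence of pairwise distinct vertices. -/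
@[ext]
structure Ray (r : V → V → Prop) where
  seq : ℕ → V
  adj : ∀ n, r (seq n) (seq (n + 1))
  inj : Function.Injective seq

namespace FinPath

variable {r : V → V → Prop}

/-- The first vertex of a path. -/
def first (P : FinPath r) : V := P.verts.head P.ne_nil

/-- The last vertex of a path. -/
def last (P : FinPath r) : V := P.verts.getLast P.ne_nil

/-- The vertex set of a path. -/
def support (P : FinPath r) : Set V := {v | v ∈ P.verts}

end FinPath

/-- The first vertex of a ray. -/
def Ray.first {r : V → V → Prop} (R : Ray r) : V := R.seq 0

/-- The vertex set of a ray. -/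
def Ray.support {r : V → V → Prop} (R : Ray r) : Set V := Set.range R.seq

/-- The first vertex of a path or ray. -/
def start {r : V → V → Prop} : FinPath r ⊕ Ray r → V :=
  Sum.elim FinPath.first Ray.first

/-- The vertex set of a path or ray. -/
def support {r : V → V → Prop} : FinPath r ⊕ Ray r → Set V :=
  Sum.elim FinPath.support Ray.support

/-- A ray `R` dominates `B` if there are infinitely many vertex-disjoint paths from `R` to `B`. -/
def RayDominates (r : V → V → Prop) (B : Set V) (R : Ray r) : Prop :=
  ∃ F : Set (FinPath r), F.Infinite ∧
    (∀ P ∈ F, P.first ∈ R.support ∧ P.last ∈ B) ∧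
    F.Pairwise (fun P Q => Disjoint P.support Q.support)

/-- A vertex `v` dominates `B` if there are infinitely many paths from `v` to `B` that are
vertex-disjoint except in `v`. -/
def VertexDominates (r : V → V → Prop) (B : Set V) (v : V) : Prop :=
  ∃ F : Set (FinPath r), F.Infinite ∧
    (∀ P ∈ F, P.first = v ∧ P.last ∈ B) ∧
    F.Pairwise (fun P Q => P.support ∩ Q.support = {v})

/-- A path or ray ends in `B` (if it is a path) or else dominates `B`. A path dominates `B` if its
last vertex does. -/
def EndsInOrDominates (r : V → V → Prop) (B : Set V) : FinPath r ⊕ Ray r → Prop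
  | Sum.inl P => P.last ∈ B ∨ VertexDominates r B P.last
  | Sum.inr R => RayDominates r B R

/-- A domination linkage from `A` to `B`: a family of vertex-disjoint paths or rays `Q a`, for
`a ∈ A`, where `Q a` starts in `a` and either ends in a vertex of `B` or else dominates `B`. -/
def IsDominationLinkage (r : V → V → Prop) (A B : Set V) (Q : A → FinPath r ⊕ Ray r) : Prop :=
  (∀ a : A, start (Q a) = a) ∧
  (∀ a b : A, a ≠ b → Disjoint (support (Q a)) (support (Q b))) ∧
  ∀ a : A, EndsInOrDominates r B (Q a)

/-- The (whole) set `S` can be linked to `B` by vertex-disjoint paths. -/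
def Linkable (r : V → V → Prop) (S B : Set V) : Prop :=
  ∃ P : S → FinPath r,
    (∀ s : S, (P s).first = s ∧ (P s).last ∈ B) ∧
    ∀ s t : S, s ≠ t → Disjoint (P s).support (P t).support

/-! Ends of an undirected graph, and a topology on its vertices and ends. -/

section Ends

variable (G : SimpleGraph V)

/-- The ray `R` has a tail in the component `C` of `G - X`. -/
def HasTailIn {X : Finset V} (R : Ray G.Adj) (C : G.ComponentCompl (X : Set V)) : Prop :=
  ∀ᶠ n in atTop, R.seq n ∈ C

theorem exists_hasTailIn (R : Ray G.Adj) (X : Finset V) :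
    ∃ C : G.ComponentCompl (X : Set V), HasTailIn G R C := by
  have hfin : (R.seq ⁻¹' (X : Set V)).Finite := X.finite_toSet.preimage R.inj.injOn
  obtain ⟨N, hN⟩ := hfin.bddAbove
  have hout : ∀ n, N + 1 ≤ n → R.seq n ∉ (X : Set V) := fun n hn hx => by
    have := hN hx
    omega
  refine ⟨G.componentComplMk (hout (N + 1) le_rfl), eventually_atTop.2 ⟨N + 1, fun n hn => ?_⟩⟩
  induction n, hn using Nat.le_induction with
  | base => exact G.componentComplMk_mem _
  | succ n hn ih =>
    obtain ⟨h, e⟩ := ih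
    exact ⟨hout (n + 1) (by omega), by
      rw [← e]; exact (G.componentComplMk_eq_of_adj _ _ (R.adj n)).symm⟩

theorem hasTailIn_unique {R : Ray G.Adj} {X : Finset V} {C D : G.ComponentCompl (X : Set V)}
    (hC : HasTailIn G R C) (hD : HasTailIn G R D) : C = D := by
  obtain ⟨n, ⟨h, e⟩, ⟨h', e'⟩⟩ := (hC.and hD).exists
  rw [← e, ← e']

/-- Two rays are equivalent if, for every finite set `X` of vertices, they have tails in the same
component of `G - X`. -/
def RayEquiv (R R' : Ray G.Adj) : Prop :=
  ∀ X : Finset V, ∃ C : G.ComponentCompl (X : Set V), HasTailIn G R C ∧ HasTailIn G R' C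

theorem rayEquiv_equivalence : Equivalence (RayEquiv G) where
  refl R X := (exists_hasTailIn G R X).imp fun _ h => ⟨h, h⟩
  symm h X := (h X).imp fun _ h => ⟨h.2, h.1⟩
  trans h h' X := by
    obtain ⟨C, h1, h2⟩ := h X
    obtain ⟨D, h3, h4⟩ := h' X
    obtain rfl := hasTailIn_unique G h2 h3
    exact ⟨C, h1, h4⟩

/-- The setoid of equivalent rays. -/
def raySetoid : Setoid (Ray G.Adj) := ⟨RayEquiv G, rayEquiv_equivalence G⟩

/-- The ends of `G`: equivalence classes of rays. -/
def Ends : Type u := Quotient (raySetoid G)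

/-- The end of `G` to which a ray belongs. -/
def endOf (R : Ray G.Adj) : Ends G := Quotient.mk (raySetoid G) R

/-- The space of all vertices and ends of `G`. -/
def VertexEndSpace : Type u := V ⊕ Ends G

/-- A vertex as a point of the space. -/
def ofVertex (v : V) : VertexEndSpace G := Sum.inl v

/-- An end as a point of the space. -/
def ofEnd (ω : Ends G) : VertexEndSpace G := Sum.inr ω

/-- The basic open set given by a component `C` of `G - X`: the vertices of `C` together with the
ends that have rays in `C`. -/
def basicOpen {X : Finset V} (C : G.ComponentCompl (X : Set V)) : Set (VertexEndSpace G) :=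
  ofVertex G '' (C : Set V) ∪
    ofEnd G '' {ω | ∃ R : Ray G.Adj, endOf G R = ω ∧ R.support ⊆ (C : Set V)}

/-- The topology on vertices and ends generated by the components of the graphs `G - X`, where `X`
is a finite set of vertices, each taken with the ends that have rays in it. -/
instance : TopologicalSpace (VertexEndSpace G) :=
  TopologicalSpace.generateFrom
    {U | ∃ (X : Finset V) (C : G.ComponentCompl (X : Set V)), U = basicOpen G C}

/-- The closure of a vertex set among the vertices and ends. -/
def vertexClosure (B : Set V) : Set (VertexEndSpace G) := closure (ofVertex G '' B)

/-- The point to which a path or ray leads: the last vertex of a path, the end of a ray. -/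
def terminus : FinPath G.Adj ⊕ Ray G.Adj → VertexEndSpace G :=
  Sum.elim (fun P => ofVertex G P.last) (fun R => ofEnd G (endOf G R))

/-- `A` can be linked by vertex-disjoint paths and rays to the closure of `B`. -/
def LinkableToClosure (A B : Set V) : Prop :=
  ∃ Q : A → FinPath G.Adj ⊕ Ray G.Adj,
    (∀ a : A, start (Q a) = a) ∧
    (∀ a b : A, a ≠ b → Disjoint (support (Q a)) (support (Q b))) ∧
    ∀ a : A, terminus G (Q a) ∈ vertexClosure G B

end Ends

end DomLink

/-! Both parts reduce to one equivalence for an arbitrary relation `r`.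

From a domination linkage to finite linkages, the argument is Menger's theorem. If a finite `S ⊆ A`
were not linkable, fewer than `|S|` vertices would separate it from `B`
(`exists_separator_of_not_linkable`), so some `Q s` misses this separator. If `Q s` dominates `B`,
one of infinitely many paths witnessing this also misses the finite separator, so in every case `B`
is reached without crossing it.

For the converse, edges receive well-ordered costs, in which the number of edges counts first and
ties are broken so that the cost determines the edges (`exists_cost`). Each finite subset of `A`
then has a cheapest linkage. An ultrafilter on the finite subsets gives a limit: an edge is kept if
it is used by almost all of these linkages. The limit is a partial injection, so following it from
each `a` gives disjoint paths and rays. Two facts show that they end correctly. If the last vertex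
of a limit path neither lies in `B` nor dominates it, then cheapest linkages continue the path in
only finitely many ways (`exists_finite_successors`), so the ultrafilter selects a continuation. If
a ray does not dominate `B`, then cheapest linkages follow it only for a bounded length
(`exists_bound_of_not_rayDominates`). Both rest on exchanging two linkages along an alternating
trajectory (`IsLink.exchange`), which preserves their total cost.

For the undirected statement, a point lies in the closure of `B` exactly if no finite vertex set
separates it from `B`. A maximal finite family of disjoint paths supplies a separator whenever
domination fails, so closure and domination agree. -/

namespace DomLink

open Relation

/-! ### Paths as sequences, reachability, and following a partial injection -/

section Paths

variable {V : Type u} {r : V → V → Prop}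

/-- The path through the first `n + 1` terms of a sequence. -/
def FinPath.ofSeq (p : ℕ → V) (n : ℕ) (adj : ∀ i < n, r (p i) (p (i + 1)))
    (inj : Set.InjOn p (Set.Iic n)) : FinPath r where
  verts := (List.range (n + 1)).map p
  ne_nil := by simp
  chain := by
    rw [List.isChain_iff_getElem]
    intro i hi
    simp only [List.length_map, List.length_range] at hi
    simpa using adj i (by omega)
  nodup := by
    refine List.Nodup.map_on (fun x hx y hy h => inj ?_ ?_ h) List.nodup_range
    · simp at hx ⊢; omega
    · simp at hy ⊢; omega

namespace FinPath

theorem first_ofSeq (p : ℕ → V) (n : ℕ) (adj : ∀ i < n, r (p i) (p (i + 1)))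
    (inj : Set.InjOn p (Set.Iic n)) : (ofSeq p n adj inj).first = p 0 := by
  simp [ofSeq, first]

theorem last_ofSeq (p : ℕ → V) (n : ℕ) (adj : ∀ i < n, r (p i) (p (i + 1)))
    (inj : Set.InjOn p (Set.Iic n)) : (ofSeq p n adj inj).last = p n := by
  simp [ofSeq, last, List.getLast_eq_getElem]

theorem support_ofSeq (p : ℕ → V) (n : ℕ) (adj : ∀ i < n, r (p i) (p (i + 1)))
    (inj : Set.InjOn p (Set.Iic n)) : (ofSeq p n adj inj).support = p '' Set.Iic n := by
  ext v
  simp [ofSeq, support]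

theorem exists_seq (P : FinPath r) : ∃ (p : ℕ → V) (n : ℕ),
    (∀ i < n, r (p i) (p (i + 1))) ∧ Set.InjOn p (Set.Iic n) ∧
    P.first = p 0 ∧ P.last = p n ∧ P.support = p '' Set.Iic n := by
  have hpos : 0 < P.verts.length := List.length_pos_of_ne_nil P.ne_nil
  have key : ∀ i (hi : i < P.verts.length), P.verts.getD i P.first = P.verts[i] := fun i hi => by
    simp [List.getD_eq_getElem?_getD, hi]
  refine ⟨fun i => P.verts.getD i P.first, P.verts.length - 1, ?_, ?_, ?_, ?_, ?_⟩
  · intro i hi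
    beta_reduce
    rw [key i (by omega), key (i + 1) (by omega)]
    exact List.isChain_iff_getElem.1 P.chain i (by omega)
  · intro i hi j hj h
    simp only [Set.mem_Iic] at hi hj
    simp only [key i (by omega), key j (by omega)] at h
    exact (P.nodup.getElem_inj_iff).1 h
  · simp only [key 0 hpos]
    simp [first, List.head_eq_getElem]
  · simp only [key _ (Nat.sub_lt hpos one_pos)]
    simp [last, List.getLast_eq_getElem]
  · ext v
    simp only [support, Set.mem_ofPred_eq, Set.mem_image, Set.mem_Iic, List.mem_iff_getElem]
    constructor
    · rintro ⟨i, hi, rfl⟩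
      exact ⟨i, by omega, key i hi⟩
    · rintro ⟨i, hi, rfl⟩
      exact ⟨i, by omega, (key i (by omega)).symm⟩

theorem first_mem_support (P : FinPath r) : P.first ∈ P.support := List.head_mem _

theorem last_mem_support (P : FinPath r) : P.last ∈ P.support := List.getLast_mem _

theorem finite_support (P : FinPath r) : P.support.Finite := P.verts.finite_toSet

/-- A path for a relation is a path for every weaker relation. -/
def mono {s : V → V → Prop} (h : ∀ v w, r v w → s v w) (P : FinPath r) : FinPath s :=
  ⟨P.verts, P.ne_nil, P.chain.imp h, P.nodup⟩

theorem reach_of_mem_support (P : FinPath r) {v : V} (hv : v ∈ P.support) :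
    ReflTransGen (fun x y => r x y ∧ x ∈ P.support ∧ y ∈ P.support) P.first v ∧
    ReflTransGen (fun x y => r x y ∧ x ∈ P.support ∧ y ∈ P.support) v P.last := by
  obtain ⟨p, n, adj, -, h0, hn, hs⟩ := P.exists_seq
  rw [hs] at hv ⊢
  obtain ⟨i, hi, rfl⟩ := hv
  rw [h0, hn]
  simp only [Set.mem_Iic] at hi
  have step : ∀ j < n, r (p j) (p (j + 1)) ∧ p j ∈ p '' Set.Iic n ∧ p (j + 1) ∈ p '' Set.Iic n :=
    fun j hj => ⟨adj j hj, ⟨j, hj.le, rfl⟩, ⟨j + 1, hj, rfl⟩⟩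
  constructor
  · clear hn
    induction i with
    | zero => exact .refl
    | succ i ih => exact (ih (by omega)).tail (step i (by omega))
  · clear h0 hs
    obtain ⟨k, rfl⟩ := Nat.exists_eq_add_of_le hi
    clear hi hn
    induction k generalizing i with
    | zero => exact .refl
    | succ k ih =>
      refine .head (step i (by omega)) ?_
      have h := @ih (i + 1)
      rw [show i + 1 + k = i + (k + 1) by omega] at h
      exact h adj step

end FinPath

/-- Prepend vertices one at a time; when the new vertex already lies on the path, keep only the part
of the path from there on. The last clause allows restrictions built into `r` to be read off at
every vertex. -/
theorem exists_finPath_of_reflTransGen {x y : V} (h : ReflTransGen r x y) :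
    ∃ P : FinPath r, P.first = x ∧ P.last = y ∧ ∀ v ∈ P.support, ReflTransGen r x v := by
  induction h using ReflTransGen.head_induction_on with
  | refl =>
    refine ⟨⟨[y], by simp, by simp, by simp⟩, by simp [FinPath.first], by simp [FinPath.last], ?_⟩
    intro v hv
    have : v = y := by simpa [FinPath.support] using hv
    exact this ▸ .refl
  | @head x z hxz _ ih =>
    obtain ⟨P, hf, hl, hP⟩ := ih
    obtain ⟨p, n, adj, inj, h0, hn, hs⟩ := P.exists_seq
    by_cases hx : x ∈ P.support
    · rw [hs] at hx
      obtain ⟨i, hi, rfl⟩ := hx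
      simp only [Set.mem_Iic] at hi
      have inj' : Set.InjOn (fun j => p (i + j)) (Set.Iic (n - i)) := by
        intro j hj k hk h
        simp only [Set.mem_Iic] at hj hk
        have := inj (show i + j ∈ Set.Iic n by simp; omega) (show i + k ∈ Set.Iic n by simp; omega) h
        omega
      refine ⟨.ofSeq (fun j => p (i + j)) (n - i) (fun j hj => adj (i + j) (by omega)) inj',
        ?_, ?_, ?_⟩
      · rw [FinPath.first_ofSeq, add_zero]
      · rw [FinPath.last_ofSeq, Nat.add_sub_cancel' hi, ← hn, hl]
      · rw [FinPath.support_ofSeq]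
        rintro _ ⟨j, hj, rfl⟩
        simp only [Set.mem_Iic] at hj
        exact .head hxz (hP _ (hs ▸ ⟨i + j, by simp; omega, rfl⟩))
    · refine ⟨⟨x :: P.verts, by simp, ?_, List.nodup_cons.2 ⟨hx, P.nodup⟩⟩, by simp [FinPath.first],
        ?_, ?_⟩
      · refine P.chain.cons_of_ne_nil P.ne_nil ?_
        have : P.verts.head P.ne_nil = z := hf
        rwa [this]
      · rw [← hl]
        exact List.getLast_cons P.ne_nil
      · intro v hv
        rcases List.mem_cons.1 hv with rfl | hv
        · exact .refl
        · exact .head hxz (hP v hv)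

theorem exists_finPath_avoiding {X : Set V} {x y : V} (hx : x ∉ X)
    (h : ReflTransGen (fun v w => r v w ∧ w ∉ X) x y) :
    ∃ P : FinPath r, P.first = x ∧ P.last = y ∧ Disjoint P.support X := by
  obtain ⟨P, hf, hl, hP⟩ := exists_finPath_of_reflTransGen h
  refine ⟨P.mono fun _ _ h => h.1, hf, hl, Set.disjoint_left.2 fun v hv => ?_⟩
  rcases ReflTransGen.cases_tail (hP v hv) with rfl | ⟨_, _, h⟩
  · exact hx
  · exact h.2

theorem FinPath.reach_avoiding (P : FinPath r) {X : Set V} (h : Disjoint P.support X) {v : V}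
    (hv : v ∈ P.support) :
    ReflTransGen (fun x y => r x y ∧ y ∉ X) P.first v ∧
    ReflTransGen (fun x y => r x y ∧ y ∉ X) v P.last := by
  have h' : ∀ x y, r x y ∧ x ∈ P.support ∧ y ∈ P.support → r x y ∧ y ∉ X :=
    fun x y hxy => ⟨hxy.1, Set.disjoint_left.1 h hxy.2.2⟩
  exact ⟨ReflTransGen.mono h' _ _ (P.reach_of_mem_support hv).1,
    ReflTransGen.mono h' _ _ (P.reach_of_mem_support hv).2⟩

theorem reach_of_mem_support {Q : FinPath r ⊕ Ray r} {v : V} (hv : v ∈ support Q) :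
    ReflTransGen r (start Q) v := by
  rcases Q with P | R
  · exact ReflTransGen.mono (fun _ _ h => h.1) _ _ (P.reach_of_mem_support hv).1
  · obtain ⟨n, rfl⟩ := hv
    induction n with
    | zero => exact .refl
    | succ n ih => exact ih.tail (R.adj n)

theorem start_mem_support (Q : FinPath r ⊕ Ray r) : start Q ∈ support Q := by
  rcases Q with P | R
  · exact P.first_mem_support
  · exact ⟨0, rfl⟩

/-- Along a partial injection, distinct points without predecessors start disjoint paths and
rays. -/
theorem disjoint_support_of_leftUnique (hl : ∀ u v w, r u w → r v w → u = v)
    {Q Q' : FinPath r ⊕ Ray r} (h : ∀ v, ¬ r v (start Q)) (h' : ∀ v, ¬ r v (start Q'))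
    (hne : start Q ≠ start Q') : Disjoint (support Q) (support Q') := by
  refine Set.disjoint_left.2 fun v hv hv' => hne ?_
  have h1 := (reach_of_mem_support hv).swap
  have h2 := (reach_of_mem_support hv').swap
  rcases ReflTransGen.total_of_right_unique
    (r := Function.swap r) (fun a b c hab hac => hl _ _ _ hab hac) h1 h2 with h3 | h3
  · rcases h3.cases_head with h4 | ⟨c, hc, -⟩
    · exact h4
    · exact (h _ hc).elim
  · rcases h3.cases_head with h4 | ⟨c, hc, -⟩
    · exact h4.symm
    · exact (h' _ hc).elim

/-- Following a partial injection from a point without a predecessor yields a path that cannot be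
continued, or a ray. -/
theorem exists_maximal_path_or_ray (hl : ∀ u v w, r u w → r v w → u = v) {s : V} (hs : ∀ v, ¬ r v s) :
    ∃ Q : FinPath r ⊕ Ray r, start Q = s ∧ ∀ P, Q = Sum.inl P → ∀ w, ¬ r P.last w := by
  classical
  -- The sequence stalls once there is no successor, so injectivity is claimed only up to that
  -- index.
  let p : ℕ → V := fun n => Nat.rec s (fun _ v => if h : ∃ w, r v w then h.choose else v) n
  have hp : ∀ n, (∃ w, r (p n) w) → r (p n) (p (n + 1)) := fun n h => by
    have : p (n + 1) = h.choose := dif_pos h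
    rw [this]
    exact h.choose_spec
  have hinj : ∀ n, (∀ i < n, ∃ w, r (p i) w) → Set.InjOn p (Set.Iic n) := by
    -- Left uniqueness pulls a repetition back to one of `p 0 = s`, which would give `s` a
    -- predecessor.
    have : ∀ i j n, i < j → j ≤ n → (∀ i < n, ∃ w, r (p i) w) → p i ≠ p j := by
      intro i
      induction i with
      | zero =>
        intro j n hij hj h e
        obtain ⟨j, rfl⟩ := Nat.exists_eq_add_of_lt hij
        have h1 := hp (0 + j) (h _ (by omega))
        rw [← e] at h1
        exact hs _ h1
      | succ i ih =>
        intro j n hij hj h e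
        obtain ⟨k, rfl⟩ := Nat.exists_eq_add_of_lt hij
        have h1 := hp (i + 1 + k) (h _ (by omega))
        have h2 := hp i (h _ (by omega))
        rw [← e] at h1
        exact ih (i + 1 + k) n (by omega) (by omega) h (hl _ _ _ h2 h1)
    intro n h i hi j hj e
    simp only [Set.mem_Iic] at hi hj
    rcases lt_trichotomy i j with hij | hij | hij
    · exact (this i j n hij hj h e).elim
    · exact hij
    · exact (this j i n hij hi h e.symm).elim
  by_cases hall : ∀ n, ∃ w, r (p n) w
  · refine ⟨Sum.inr ⟨p, fun n => hp n (hall n), fun i j e => ?_⟩, rfl, by simp⟩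
    exact hinj (max i j) (fun i _ => hall i) (le_max_left i j) (le_max_right i j) e
  · rw [not_forall] at hall
    have hmin : ∀ i < Nat.find hall, ∃ w, r (p i) w := fun i hi => by
      simpa using Nat.find_min hall hi
    refine ⟨Sum.inl (.ofSeq p (Nat.find hall) (fun i hi => hp i (hmin i hi)) (hinj _ hmin)), ?_, ?_⟩
    · exact FinPath.first_ofSeq ..
    · rintro P hP w hw
      obtain rfl := Sum.inl_injective hP
      rw [FinPath.last_ofSeq] at hw
      exact Nat.find_spec hall ⟨w, hw⟩

end Paths

/-! ### Linkages as partial injections, and their exchange -/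

section Links

variable {V : Type u} {r : V → V → Prop} {B : Set V}

/-- A linkage of `S` to `B`, encoded by a partial injection `f` that sends every vertex on a path
to the next one, is undefined at the last vertices, and fixes the vertices that lie on no path. It
may contain finitely many additional cycles. -/
structure IsLink (r : V → V → Prop) (B : Set V) (f : V → Option V) (S : Set V) : Prop where
  step : ∀ v w, f v = some w → w = v ∨ r v w
  none : ∀ v, f v = none → v ∈ B
  inj : ∀ u v w, f u = some w → f v = some w → u = v
  start : ∀ x, x ∈ S ↔ ∀ v, f v ≠ some x
  fin : {v | f v ≠ some v}.Finite

theorem isLink_empty (r : V → V → Prop) (B : Set V) : IsLink r B some ∅ where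
  step v w h := by simp at h; exact Or.inl h.symm
  none v h := by simp at h
  inj u v w hu hv := by simp at hu hv; rw [hu, hv]
  start x := by simp
  fin := by simp

theorem IsLink.finite {f : V → Option V} {S : Set V} (h : IsLink r B f S) : S.Finite :=
  h.fin.subset fun x hx => (h.start x).1 hx x

theorem IsLink.mono {s : V → V → Prop} {f : V → Option V} {S : Set V} (h : IsLink r B f S)
    (hrs : ∀ v w, r v w → s v w) : IsLink s B f S :=
  ⟨fun v w e => (h.step v w e).imp_right (hrs v w), h.none, h.inj, h.start, h.fin⟩

/-- Two link functions arise from two others by interchanging values at some vertices. -/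
def IsSwap (f g f' g' : V → Option V) : Prop :=
  ∀ v, (f' v = f v ∧ g' v = g v) ∨ (f' v = g v ∧ g' v = f v)

/-- The exchange property of linkages. -/
theorem IsLink.exchange {f g : V → Option V} {S W : Set V} (hf : IsLink r B f S)
    (hg : IsLink r B g W) {w : V} (hwS : w ∈ S) (hwW : w ∉ W) :
    ∃ f' g', IsSwap f g f' g' ∧
      (IsLink r B g' (insert w W) ∨
        ∃ u ∈ W, u ∉ S ∧ IsLink r B f' (insert u (S \ {w})) ∧ IsLink r B g' (insert w (W \ {u}))) := by
  classical
  -- The alternating trajectory of `w` goes back along `g` and forward along `f`. `O` is its set of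
  -- vertices and `C` the set of vertices where it turns; `f` and `g` are interchanged on `C` only.
  let t : V → V → Prop := fun x y => ∃ v, g v = some x ∧ f v = some y
  have ht : Relator.RightUnique t := by
    rintro x y z ⟨v, h1, h2⟩ ⟨v', h3, h4⟩
    obtain rfl := hg.inj _ _ _ h1 h3
    exact Option.some_injective _ (h2.symm.trans h4)
  let O : Set V := {x | ReflTransGen t w x}
  let C : Set V := {v | ∃ x ∈ O, g v = some x}
  have hwO : w ∈ O := ReflTransGen.refl
  have hO : ∀ y ∈ O, y ≠ w → ∃ v ∈ C, f v = some y := by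
    intro y hy hne
    rcases ReflTransGen.cases_tail hy with h | ⟨x, hx, v, h1, h2⟩
    · exact (hne h).elim
    · exact ⟨v, ⟨x, hx, h1⟩, h2⟩
  have hC : ∀ v ∈ C, ∀ y, f v = some y → y ∈ O := by
    rintro v ⟨x, hx, hgv⟩ y hy
    exact ReflTransGen.tail hx ⟨v, hgv, hy⟩
  -- Since `w` has no `f`-predecessor, `O` has the same preimages inside `C` whether taken under `f`
  -- or `g`. This keeps both interchanged functions injective.
  have hC' : ∀ v, ∀ y ∈ O, f v = some y → v ∈ C := by
    intro v y hy h
    have hne : y ≠ w := fun e => (hf.start w).1 hwS v (e ▸ h)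
    obtain ⟨v', hv', h'⟩ := hO y hy hne
    exact hf.inj _ _ _ h h' ▸ hv'
  let f' : V → Option V := fun v => if v ∈ C then g v else f v
  let g' : V → Option V := fun v => if v ∈ C then f v else g v
  have f'C : ∀ v ∈ C, f' v = g v := fun v h => if_pos h
  have f'N : ∀ v, v ∉ C → f' v = f v := fun v h => if_neg h
  have g'C : ∀ v ∈ C, g' v = f v := fun v h => if_pos h
  have g'N : ∀ v, v ∉ C → g' v = g v := fun v h => if_neg h
  have hswap : IsSwap f g f' g' := fun v => by
    by_cases h : v ∈ C
    · exact Or.inr ⟨f'C v h, g'C v h⟩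
    · exact Or.inl ⟨f'N v h, g'N v h⟩
  have hf' : IsLink r B f' ((O ∩ W) ∪ (S \ O)) := by
    refine ⟨?_, ?_, ?_, ?_, ?_⟩
    · intro v x h
      rcases hswap v with ⟨e, -⟩ | ⟨e, -⟩ <;> rw [e] at h
      exacts [hf.step v x h, hg.step v x h]
    · intro v h
      rcases hswap v with ⟨e, -⟩ | ⟨e, -⟩ <;> rw [e] at h
      exacts [hf.none v h, hg.none v h]
    · intro u v x hu hv
      by_cases huC : u ∈ C <;> by_cases hvC : v ∈ C
      · rw [f'C _ huC] at hu
        rw [f'C _ hvC] at hv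
        exact hg.inj _ _ _ hu hv
      · rw [f'C _ huC] at hu
        rw [f'N _ hvC] at hv
        obtain ⟨y, hy, e⟩ := huC
        rw [e] at hu
        obtain rfl := Option.some_injective _ hu
        exact (hvC (hC' v y hy hv)).elim
      · rw [f'N _ huC] at hu
        rw [f'C _ hvC] at hv
        obtain ⟨y, hy, e⟩ := hvC
        rw [e] at hv
        obtain rfl := Option.some_injective _ hv
        exact (huC (hC' u y hy hu)).elim
      · rw [f'N _ huC] at hu
        rw [f'N _ hvC] at hv
        exact hf.inj _ _ _ hu hv
    · intro x
      by_cases hx : x ∈ O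
      · have : x ∈ (O ∩ W) ∪ (S \ O) ↔ x ∈ W := by simp [hx]
        rw [this, hg.start]
        refine ⟨fun h v e => ?_, fun h v e => h v ?_⟩
        · by_cases hv : v ∈ C
          · exact h v (f'C v hv ▸ e)
          · exact hv (hC' v x hx (f'N v hv ▸ e))
        · rw [f'C v ⟨x, hx, e⟩, e]
      · have : x ∈ (O ∩ W) ∪ (S \ O) ↔ x ∈ S := by simp [hx]
        rw [this, hf.start]
        refine ⟨fun h v e => ?_, fun h v e => h v ?_⟩
        · by_cases hv : v ∈ C
          · rw [f'C v hv] at e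
            obtain ⟨y, hy, e'⟩ := hv
            rw [e'] at e
            exact hx (Option.some_injective _ e ▸ hy)
          · exact h v (f'N v hv ▸ e)
        · rw [f'N v fun hv => hx (hC v hv x e), e]
    · refine (hf.fin.union hg.fin).subset fun v hv => ?_
      rcases hswap v with ⟨e, -⟩ | ⟨e, -⟩
      · exact Or.inl (by simpa [e] using hv)
      · exact Or.inr (by simpa [e] using hv)
  have hg' : IsLink r B g' (insert w (W \ O)) := by
    refine ⟨?_, ?_, ?_, ?_, ?_⟩
    · intro v x h
      rcases hswap v with ⟨-, e⟩ | ⟨-, e⟩ <;> rw [e] at h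
      exacts [hg.step v x h, hf.step v x h]
    · intro v h
      rcases hswap v with ⟨-, e⟩ | ⟨-, e⟩ <;> rw [e] at h
      exacts [hg.none v h, hf.none v h]
    · intro u v x hu hv
      by_cases huC : u ∈ C <;> by_cases hvC : v ∈ C
      · rw [g'C _ huC] at hu
        rw [g'C _ hvC] at hv
        exact hf.inj _ _ _ hu hv
      · rw [g'C _ huC] at hu
        rw [g'N _ hvC] at hv
        exact (hvC ⟨x, hC u huC x hu, hv⟩).elim
      · rw [g'N _ huC] at hu
        rw [g'C _ hvC] at hv
        exact (huC ⟨x, hC v hvC x hv, hu⟩).elim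
      · rw [g'N _ huC] at hu
        rw [g'N _ hvC] at hv
        exact hg.inj _ _ _ hu hv
    · intro x
      by_cases hx : x ∈ O
      · have : x ∈ insert w (W \ O) ↔ x = w := by simp [hx]
        rw [this]
        refine ⟨?_, fun h => ?_⟩
        · rintro rfl v e
          by_cases hv : v ∈ C
          · exact (hf.start x).1 hwS v (g'C v hv ▸ e)
          · exact hv ⟨x, hx, g'N v hv ▸ e⟩
        · by_contra hne
          obtain ⟨v, hv, e⟩ := hO x hx hne
          exact h v ((g'C v hv).trans e)
      · have hxw : x ≠ w := fun e => hx (e ▸ hwO)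
        have : x ∈ insert w (W \ O) ↔ x ∈ W := by simp [hx, hxw]
        rw [this, hg.start]
        refine ⟨fun h v e => ?_, fun h v e => h v ?_⟩
        · by_cases hv : v ∈ C
          · exact hx (hC v hv x (g'C v hv ▸ e))
          · exact h v (g'N v hv ▸ e)
        · rw [g'N v, e]
          rintro ⟨y, hy, e'⟩
          rw [e'] at e
          exact hx (Option.some_injective _ e ▸ hy)
    · refine (hf.fin.union hg.fin).subset fun v hv => ?_
      rcases hswap v with ⟨-, e⟩ | ⟨-, e⟩
      · exact Or.inr (by simpa [e] using hv)
      · exact Or.inl (by simpa [e] using hv)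
  have hOS : ∀ x ∈ O, x ∈ S → x = w := by
    intro x hx hxS
    by_contra hne
    obtain ⟨v, -, e⟩ := hO x hx hne
    exact (hf.start x).1 hxS v e
  refine ⟨f', g', hswap, ?_⟩
  by_cases hOW : (O ∩ W).Nonempty
  · right
    obtain ⟨u, hu, huW⟩ := hOW
    -- A vertex of `W` has no `g`-predecessor, so the trajectory stops there; being deterministic,
    -- it stops at most once.
    have huniq : ∀ x ∈ O, x ∈ W → x = u := by
      intro x hx hxW
      have hend : ∀ y ∈ W, ∀ z, ¬ t y z := fun y hy z ⟨v, h, _⟩ => (hg.start y).1 hy v h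
      rcases ReflTransGen.total_of_right_unique ht hx hu with h | h
      · rcases h.cases_head with h | ⟨c, hc, -⟩
        · exact h
        · exact (hend x hxW c hc).elim
      · rcases h.cases_head with h | ⟨c, hc, -⟩
        · exact h.symm
        · exact (hend u huW c hc).elim
    refine ⟨u, huW, fun huS => hwW (hOS u hu huS ▸ huW), ?_, ?_⟩
    · convert hf' using 1
      ext x
      simp only [Set.mem_insert_iff, Set.mem_sdiff, Set.mem_singleton_iff, Set.mem_union,
        Set.mem_inter_iff]
      constructor
      · rintro (rfl | ⟨h1, h2⟩)
        · exact Or.inl ⟨hu, huW⟩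
        · exact Or.inr ⟨h1, fun h => h2 (hOS x h h1)⟩
      · rintro (⟨h1, h2⟩ | ⟨h1, h2⟩)
        · exact Or.inl (huniq x h1 h2)
        · exact Or.inr ⟨h1, fun e => h2 (e ▸ hwO)⟩
    · convert hg' using 1
      congr 1
      ext x
      simp only [Set.mem_sdiff, Set.mem_singleton_iff]
      exact ⟨fun h => ⟨h.1, fun hx => h.2 (huniq x hx h.1)⟩, fun h => ⟨h.1, fun e => h.2 (e ▸ hu)⟩⟩
  · left
    convert hg' using 2
    ext x
    exact ⟨fun h => ⟨h, fun hx => hOW ⟨x, hx, h⟩⟩, fun h => h.1⟩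

/-! ### Costs of linkages, and editing initial segments -/

section Cost

variable {Γ : Type*} [AddCommMonoid Γ] (c : V → V → Γ)

open Classical in
/-- The cost of the step that a link function makes at a vertex. -/
noncomputable def stepCost (v : V) : Option V → Γ
  | none => 0
  | some w => if w = v then 0 else c v w

/-- The total cost of the edges of a link function. -/
noncomputable def cost (f : V → Option V) : Γ := ∑ᶠ v, stepCost c v (f v)

variable {c}

theorem IsLink.finite_support_stepCost {f : V → Option V} {S : Set V} (hf : IsLink r B f S) :
    (Function.support fun v => stepCost c v (f v)).Finite :=
  hf.fin.subset fun v hv e => hv (by simp [e, stepCost])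

/-- At each vertex the same two steps are made, only in a different order. Hence what one linkage
gains in an exchange, the other loses. -/
theorem IsSwap.cost_add_cost {f g f' g' : V → Option V} (h : IsSwap f g f' g')
    {S₁ S₂ S₃ S₄ : Set V} (h₁ : IsLink r B f S₁) (h₂ : IsLink r B g S₂) (h₃ : IsLink r B f' S₃)
    (h₄ : IsLink r B g' S₄) : cost c f' + cost c g' = cost c f + cost c g := by
  unfold cost
  rw [← finsum_add_distrib h₁.finite_support_stepCost h₂.finite_support_stepCost,
    ← finsum_add_distrib h₃.finite_support_stepCost h₄.finite_support_stepCost]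
  refine finsum_congr fun v => ?_
  rcases h v with ⟨e, e'⟩ | ⟨e, e'⟩
  · rw [e, e']
  · rw [e, e', add_comm]

theorem IsLink.cost_update {f : V → Option V} {S : Set V} (hf : IsLink r B f S)
    [DecidableEq V] {a w : V} (ha : f a = some a) (hw : w ≠ a) :
    cost c (Function.update f a (some w)) = cost c f + c a w := by
  have h : ∀ v, stepCost c v (Function.update f a (some w) v) =
      stepCost c v (f v) + if v = a then c a w else 0 := by
    intro v
    by_cases hv : v = a
    · subst hv
      simp [stepCost, ha, hw]
    · simp [hv]
  unfold cost
  rw [finsum_congr h, finsum_add_distrib hf.finite_support_stepCost]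
  · congr 1
    rw [finsum_eq_single _ a]
    · simp
    · intro x hx
      simp [hx]
  · refine (Set.finite_singleton a).subset fun v hv => ?_
    by_contra hne
    exact hv (if_neg hne)

/-- Removing the first edge of a path. -/
theorem IsLink.cut {f : V → Option V} {S : Set V} (hf : IsLink r B f S) [DecidableEq V] {a w : V}
    (ha : a ∈ S) (hw : f a = some w) :
    IsLink r B (Function.update f a (some a)) (insert w (S \ {a})) ∧
      cost c f = cost c (Function.update f a (some a)) + c a w := by
  have hwa : w ≠ a := fun e => (hf.start a).1 ha a (e ▸ hw)
  have hl : IsLink r B (Function.update f a (some a)) (insert w (S \ {a})) := by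
    refine ⟨?_, ?_, ?_, ?_, ?_⟩
    · intro v x h
      by_cases hv : v = a
      · subst hv
        simp at h
        exact Or.inl h.symm
      · exact hf.step v x (by simpa [hv] using h)
    · intro v h
      by_cases hv : v = a
      · subst hv
        simp at h
      · exact hf.none v (by simpa [hv] using h)
    · intro u v x hu hv
      by_cases hua : u = a <;> by_cases hva : v = a
      · rw [hua, hva]
      · subst hua
        simp [hva] at hu hv
        exact ((hf.start u).1 ha v (hu ▸ hv)).elim
      · subst hva
        simp [hua] at hu hv
        exact ((hf.start v).1 ha u (hv ▸ hu)).elim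
      · simp [hua, hva] at hu hv
        exact hf.inj _ _ _ hu hv
    · intro x
      simp only [Set.mem_insert_iff, Set.mem_sdiff, Set.mem_singleton_iff]
      constructor
      · rintro (rfl | ⟨h1, h2⟩) v hv
        · by_cases hva : v = a
          · subst hva
            simp at hv
            exact hwa hv.symm
          · simp [hva] at hv
            exact hva (hf.inj _ _ _ hv hw)
        · by_cases hva : v = a
          · subst hva
            simp at hv
            exact h2 hv.symm
          · simp [hva] at hv
            exact (hf.start x).1 h1 v hv
      · intro h
        by_cases hxw : x = w
        · exact Or.inl hxw
        · refine Or.inr ⟨(hf.start x).2 fun v hv => ?_, ?_⟩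
          · by_cases hva : v = a
            · subst hva
              rw [hv] at hw
              exact hxw (Option.some_injective _ hw)
            · exact h v (by simpa [hva] using hv)
          · rintro rfl
            exact h x (by simp)
    · refine hf.fin.subset fun v hv => ?_
      by_cases hva : v = a
      · subst hva
        simp at hv
      · simpa [hva] using hv
  refine ⟨hl, ?_⟩
  rw [← hl.cost_update (c := c) (by simp) hwa, Function.update_idem, ← hw, Function.update_eq_self]

/-- Adding a first edge to a path. -/
theorem IsLink.extend {f : V → Option V} {T : Set V} {a w : V} (hf : IsLink r B f (insert w T))
    [DecidableEq V] (hwT : w ∉ T) (ha : f a = some a) (haw : r a w) :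
    IsLink r B (Function.update f a (some w)) (insert a T) ∧
      cost c (Function.update f a (some w)) = cost c f + c a w := by
  have hns : a ∉ insert w T := fun h => (hf.start a).1 h a ha
  have hwa : w ≠ a := fun e => hns (Or.inl e.symm)
  refine ⟨⟨?_, ?_, ?_, ?_, ?_⟩, hf.cost_update ha hwa⟩
  · intro v x h
    by_cases hv : v = a
    · subst hv
      simp at h
      exact Or.inr (h ▸ haw)
    · exact hf.step v x (by simpa [hv] using h)
  · intro v h
    by_cases hv : v = a
    · subst hv
      simp at h
    · exact hf.none v (by simpa [hv] using h)
  · have hw := (hf.start w).1 (Or.inl rfl)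
    intro u v x hu hv
    by_cases hua : u = a <;> by_cases hva : v = a
    · rw [hua, hva]
    · subst hua
      simp [hva] at hu hv
      exact (hw v (hu ▸ hv)).elim
    · subst hva
      simp [hua] at hu hv
      exact (hw u (hv ▸ hu)).elim
    · simp [hua, hva] at hu hv
      exact hf.inj _ _ _ hu hv
  · intro x
    simp only [Set.mem_insert_iff]
    constructor
    · rintro (rfl | h1) v hv
      · by_cases hva : v = x
        · subst hva
          simp at hv
          exact hwa hv
        · simp [hva] at hv
          exact hva (hf.inj _ _ _ hv ha)
      · by_cases hva : v = a
        · subst hva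
          simp at hv
          exact hwT (hv ▸ h1)
        · simp [hva] at hv
          exact (hf.start x).1 (Or.inr h1) v hv
    · intro h
      by_cases hxa : x = a
      · exact Or.inl hxa
      · right
        have hxw : x ≠ w := fun e => h a (by simp [e])
        have : x ∈ insert w T := (hf.start x).2 fun v hv => by
          by_cases hva : v = a
          · subst hva
            rw [ha] at hv
            exact hxa (Option.some_injective _ hv).symm
          · exact h v (by simpa [hva] using hv)
        exact this.resolve_left hxw
  · refine (hf.fin.insert a).subset fun v hv => ?_
    by_cases hva : v = a
    · exact Or.inl hva
    · exact Or.inr (by simpa [hva] using hv)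

/-- Removing an initial segment of a path. -/
theorem IsLink.cut_segment {f : V → Option V} {S : Set V} (hf : IsLink r B f S) {p : ℕ → V} {n : ℕ}
    (hp : p 0 ∈ S) (hstep : ∀ i < n, f (p i) = some (p (i + 1))) (hinj : Set.InjOn p (Set.Iic n)) :
    ∃ f', IsLink r B f' (insert (p n) (S \ {p 0})) ∧
      cost c f = cost c f' + ∑ i ∈ Finset.range n, c (p i) (p (i + 1)) ∧
      (∀ i < n, f' (p i) = some (p i)) ∧ ∀ v, (∀ i < n, v ≠ p i) → f' v = f v := by
  classical
  induction n with
  | zero => exact ⟨f, by simpa [Set.insert_eq_of_mem hp] using hf, by simp, by simp, by simp⟩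
  | succ n ih =>
    obtain ⟨f', h1, h2, h3, h4⟩ := ih (fun i hi => hstep i (by omega))
      (hinj.mono (Set.Iic_subset_Iic.2 n.le_succ))
    have hne : ∀ i < n, p n ≠ p i := fun i hi e => by
      have := hinj (show n ∈ Set.Iic (n + 1) by simp) (show i ∈ Set.Iic (n + 1) by simp; omega) e
      omega
    have hfn : f' (p n) = some (p (n + 1)) := (h4 _ hne).trans (hstep n (by omega))
    obtain ⟨h5, h6⟩ := h1.cut (c := c) (Set.mem_insert _ _) hfn
    have hset : insert (p n) (S \ {p 0}) \ {p n} = S \ {p 0} := by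
      refine Set.insert_sdiff_self_of_notMem ?_
      rintro ⟨hS, h0⟩
      cases n with
      | zero => exact h0 rfl
      | succ n => exact (hf.start _).1 hS _ (hstep n (by omega))
    rw [hset] at h5
    refine ⟨_, h5, ?_, ?_, ?_⟩
    · rw [h2, h6, Finset.sum_range_succ, add_assoc, add_comm (c _ _)]
    · intro i hi
      by_cases hin : i = n
      · subst hin
        simp
      · rw [Function.update_of_ne (hne i (by omega)).symm, h3 i (by omega)]
    · intro v hv
      rw [Function.update_of_ne (hv n (by omega)), h4 v fun i hi => hv i (by omega)]

/-- Adding an initial segment to a path. -/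
theorem IsLink.extend_segment {f : V → Option V} {T : Set V} {p : ℕ → V} {n : ℕ}
    (hf : IsLink r B f (insert (p n) T)) (hT : p n ∉ T) (hfix : ∀ i < n, f (p i) = some (p i))
    (hr : ∀ i < n, r (p i) (p (i + 1))) (hinj : Set.InjOn p (Set.Iic n)) :
    ∃ f', IsLink r B f' (insert (p 0) T) ∧
      cost c f' = cost c f + ∑ i ∈ Finset.range n, c (p i) (p (i + 1)) ∧
      (∀ i < n, f' (p i) = some (p (i + 1))) ∧ ∀ v, (∀ i < n, v ≠ p i) → f' v = f v := by
  classical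
  induction n generalizing f with
  | zero => exact ⟨f, hf, by simp, by simp, by simp⟩
  | succ n ih =>
    obtain ⟨h1, h2⟩ := hf.extend (c := c) hT (hfix n (by omega)) (hr n (by omega))
    have hne : ∀ i < n, p i ≠ p n := fun i hi e => by
      have := hinj (show i ∈ Set.Iic (n + 1) by simp; omega) (show n ∈ Set.Iic (n + 1) by simp) e
      omega
    have hnT : p n ∉ T := fun h => (hf.start _).1 (Or.inr h) _ (hfix n (by omega))
    obtain ⟨f', h3, h4, h5, h6⟩ := ih h1 hnT
      (fun i hi => by rw [Function.update_of_ne (hne i hi), hfix i (by omega)])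
      (fun i hi => hr i (by omega)) (hinj.mono (Set.Iic_subset_Iic.2 n.le_succ))
    refine ⟨f', h3, ?_, ?_, ?_⟩
    · rw [h4, h2, Finset.sum_range_succ, add_assoc, add_comm (c _ _)]
    · intro i hi
      by_cases hin : i = n
      · subst hin
        rw [h6 _ fun j hj => (hne j hj).symm, Function.update_self]
      · exact h5 i (by omega)
    · intro v hv
      rw [h6 v fun i hi => hv i (by omega), Function.update_of_ne (hv n (by omega))]

end Cost

end Links

/-! ### Passing between families of paths and link functions -/

section PathsOfLinks

variable {V : Type u} {r : V → V → Prop} {B : Set V}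

/-- The paths of a link function. -/
theorem IsLink.exists_finPath {f : V → Option V} {S : Set V} (hf : IsLink r B f S) :
    ∃ P : S → FinPath r, (∀ s : S, (P s).first = s ∧ (P s).last ∈ B) ∧
      (∀ s t : S, s ≠ t → Disjoint (P s).support (P t).support) ∧
      ∀ s : S, ∀ v ∈ (P s).support, f v ≠ some v := by
  let L : V → V → Prop := fun v w => f v = some w ∧ w ≠ v
  have hl : ∀ u v w, L u w → L v w → u = v := fun u v w h h' => hf.inj _ _ _ h.1 h'.1
  have hs : ∀ s ∈ S, ∀ v, ¬ L v s := fun s hs v h => (hf.start s).1 hs v h.1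
  have hfix : ∀ s ∈ S, ∀ v, ReflTransGen L s v → f v ≠ some v := by
    intro s hs v h e
    rcases h.cases_tail with rfl | ⟨u, -, h1, h2⟩
    · exact (hf.start _).1 hs _ e
    · exact h2 (hf.inj _ _ _ e h1)
  have key : ∀ s : S, ∃ P : FinPath L, P.first = s ∧ P.last ∈ B := by
    intro s
    obtain ⟨Q, h1, h2⟩ := exists_maximal_path_or_ray hl (hs s s.2)
    rcases Q with P | R
    · refine ⟨P, h1, ?_⟩
      have hlast := hfix s s.2 P.last (h1 ▸ reach_of_mem_support (Q := .inl P) P.last_mem_support)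
      cases e : f P.last with
      | none => exact hf.none _ e
      | some w => exact (h2 P rfl w ⟨e, fun h => hlast (h ▸ e)⟩).elim
    -- A ray would contain infinitely many vertices that `f` does not fix.
    · exfalso
      refine Set.infinite_range_of_injective R.inj (hf.fin.subset ?_)
      intro v hv
      exact hfix s s.2 v (h1 ▸ reach_of_mem_support (Q := .inr R) hv)
  choose P hP using key
  have hLr : ∀ v w, L v w → r v w := fun v w h => (hf.step v w h.1).resolve_left h.2
  refine ⟨fun s => (P s).mono hLr, hP, fun s t hst => ?_, fun s v hv => ?_⟩
  · have h1 : DomLink.start (Sum.inl (P s) : FinPath L ⊕ Ray L) = s := (hP s).1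
    have h2 : DomLink.start (Sum.inl (P t) : FinPath L ⊕ Ray L) = t := (hP t).1
    exact disjoint_support_of_leftUnique (Q := .inl (P s)) (Q' := .inl (P t)) hl
      (h1 ▸ hs s s.2) (h2 ▸ hs t t.2) (by rw [h1, h2]; exact fun h => hst (Subtype.ext h))
  · have h1 : DomLink.start (Sum.inl (P s) : FinPath L ⊕ Ray L) = s := (hP s).1
    exact hfix s s.2 v (h1 ▸ reach_of_mem_support (Q := .inl (P s)) hv)

theorem IsLink.linkable {f : V → Option V} {S : Set V} (hf : IsLink r B f S) : Linkable r S B := by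
  obtain ⟨P, h1, h2, -⟩ := hf.exists_finPath
  exact ⟨P, h1, h2⟩

/-- The partial successor function of a path. -/
theorem FinPath.exists_next (P : FinPath r) : ∃ f : V → Option V,
    (∀ v ∈ P.support, ∀ w, f v = some w → r v w ∧ v ≠ w ∧ w ∈ P.support) ∧
    (∀ v ∈ P.support, f v = none → v = P.last) ∧
    (∀ u ∈ P.support, ∀ v ∈ P.support, ∀ w, f u = some w → f v = some w → u = v) ∧
    (∀ u ∈ P.support, f u ≠ some P.first) ∧
    ∀ w ∈ P.support, w ≠ P.first → ∃ v ∈ P.support, f v = some w := by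
  classical
  obtain ⟨p, n, adj, inj, h0, hn, hs⟩ := P.exists_seq
  let f : V → Option V := fun v => if h : ∃ i < n, v = p i then some (p (h.choose + 1)) else none
  have hlt : ∀ i < n, f (p i) = some (p (i + 1)) := by
    intro i hi
    have h : ∃ j < n, p i = p j := ⟨i, hi, rfl⟩
    have hf : f (p i) = some (p (h.choose + 1)) := dif_pos h
    have : i = h.choose := inj hi.le h.choose_spec.1.le h.choose_spec.2
    rw [hf, ← this]
  have hsome : ∀ v w, f v = some w → ∃ i < n, v = p i ∧ w = p (i + 1) := by
    intro v w hvw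
    by_cases h : ∃ i < n, v = p i
    · obtain ⟨i, hi, rfl⟩ := h
      rw [hlt i hi] at hvw
      exact ⟨i, hi, rfl, (Option.some_injective _ hvw).symm⟩
    · have : f v = none := dif_neg h
      simp [this] at hvw
  refine ⟨f, ?_, ?_, ?_, ?_, ?_⟩
  · intro v _ w hvw
    obtain ⟨i, hi, rfl, rfl⟩ := hsome v w hvw
    refine ⟨adj i hi, fun e => ?_, hs ▸ ⟨i + 1, hi, rfl⟩⟩
    have := inj (show i ∈ Set.Iic n from hi.le) (show i + 1 ∈ Set.Iic n from hi) e
    omega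
  · intro v hv e
    rw [hs] at hv
    obtain ⟨i, hi, rfl⟩ := hv
    rcases (show i ≤ n from hi).lt_or_eq with h | rfl
    · rw [hlt i h] at e
      cases e
    · exact hn.symm
  · intro u _ v _ w hu hv
    obtain ⟨i, hi, rfl, rfl⟩ := hsome u w hu
    obtain ⟨j, hj, rfl, e⟩ := hsome v _ hv
    have := inj (show i + 1 ∈ Set.Iic n from hi) (show j + 1 ∈ Set.Iic n from hj) e
    rw [Nat.succ_injective this]
  · intro u _ e
    obtain ⟨i, hi, rfl, e'⟩ := hsome u _ e
    rw [h0] at e'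
    have := inj (show 0 ∈ Set.Iic n from Nat.zero_le n) (show i + 1 ∈ Set.Iic n from hi) e'
    omega
  · intro w hw hne
    rw [hs] at hw ⊢
    obtain ⟨i, hi, rfl⟩ := hw
    cases i with
    | zero => exact (hne h0.symm).elim
    | succ i => exact ⟨p i, ⟨i, Nat.le_of_succ_le hi, rfl⟩, hlt i hi⟩

/-- A finite family of disjoint paths gives a link function. -/
theorem Linkable.exists_isLink {S : Set V} (hS : S.Finite) (h : Linkable r S B) :
    ∃ f, IsLink r B f S := by
  classical
  obtain ⟨P, h1, h2⟩ := h
  choose F hF1 hF2 hF3 hF4 hF5 using fun s => (P s).exists_next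
  have huniq : ∀ s t : S, ∀ v, v ∈ (P s).support → v ∈ (P t).support → s = t := fun s t v hs ht => by
    by_contra hne
    exact Set.disjoint_left.1 (h2 s t hne) hs ht
  let f : V → Option V := fun v => if h : ∃ s, v ∈ (P s).support then F h.choose v else some v
  have hfP : ∀ s, ∀ v ∈ (P s).support, f v = F s v := by
    intro s v hv
    have h : ∃ s, v ∈ (P s).support := ⟨s, hv⟩
    have : f v = F h.choose v := dif_pos h
    rw [this, huniq _ _ v h.choose_spec hv]
  have hfN : ∀ v, (∀ s, v ∉ (P s).support) → f v = some v := fun v h =>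
    dif_neg fun ⟨s, hs⟩ => h s hs
  have hcase : ∀ v, (∃ s, v ∈ (P s).support ∧ f v = F s v) ∨
      (∀ s, v ∉ (P s).support) ∧ f v = some v := fun v => by
    by_cases h : ∃ s, v ∈ (P s).support
    · obtain ⟨s, hs⟩ := h
      exact Or.inl ⟨s, hs, hfP s v hs⟩
    · rw [not_exists] at h
      exact Or.inr ⟨h, hfN v h⟩
  refine ⟨f, ?_, ?_, ?_, ?_, ?_⟩
  · intro v w h
    rcases hcase v with ⟨s, hs, e⟩ | ⟨-, e⟩
    · exact Or.inr (hF1 s v hs w (e ▸ h)).1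
    · exact Or.inl (Option.some_injective _ (e.symm.trans h)).symm
  · intro v h
    rcases hcase v with ⟨s, hs, e⟩ | ⟨-, e⟩
    · rw [hF2 s v hs (e ▸ h)]
      exact (h1 s).2
    · simp [e] at h
  · intro u v w hu hv
    rcases hcase u with ⟨s, hs, e⟩ | ⟨hn, e⟩ <;> rcases hcase v with ⟨t, ht, e'⟩ | ⟨hn', e'⟩
    · have h3 := (hF1 s u hs w (e ▸ hu)).2.2
      have h4 := (hF1 t v ht w (e' ▸ hv)).2.2
      obtain rfl := huniq _ _ _ h3 h4
      exact hF3 s u hs v ht w (e ▸ hu) (e' ▸ hv)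
    · have h3 := (hF1 s u hs w (e ▸ hu)).2.2
      obtain rfl := Option.some_injective _ (e'.symm.trans hv)
      exact (hn' s h3).elim
    · have h3 := (hF1 t v ht w (e' ▸ hv)).2.2
      obtain rfl := Option.some_injective _ (e.symm.trans hu)
      exact (hn t h3).elim
    · exact Option.some_injective _ ((e.symm.trans hu).trans (hv.symm.trans e'))
  · intro x
    constructor
    · intro hx v e
      have hxP : x ∈ (P ⟨x, hx⟩).support := by
        have := (P ⟨x, hx⟩).first_mem_support
        rwa [(h1 ⟨x, hx⟩).1] at this
      rcases hcase v with ⟨s, hs, e'⟩ | ⟨hn, e'⟩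
      · have h3 := (hF1 s v hs x (e' ▸ e)).2.2
        obtain rfl := huniq _ _ _ h3 hxP
        refine hF4 _ v hs (e'.symm.trans (e.trans ?_))
        rw [(h1 _).1]
      · obtain rfl := Option.some_injective _ (e'.symm.trans e)
        exact hn _ hxP
    · intro h
      rcases hcase x with ⟨s, hs, -⟩ | ⟨-, e⟩
      · by_cases hxf : x = (P s).first
        · rw [hxf, (h1 s).1]
          exact s.2
        · obtain ⟨v, hv, e⟩ := hF5 s x hs hxf
          exact (h v ((hfP s v hv).trans e)).elim
      · exact (h x e).elim
  · have := hS.to_subtype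
    refine (Set.finite_iUnion fun s => (P s).finite_support).subset fun v hv => ?_
    rcases hcase v with ⟨s, hs, -⟩ | ⟨-, e⟩
    · exact Set.mem_iUnion.2 ⟨s, hs⟩
    · exact (hv e).elim

theorem Linkable.mono {S T : Set V} (hTS : T ⊆ S) (h : Linkable r S B) : Linkable r T B := by
  obtain ⟨P, h1, h2⟩ := h
  exact ⟨fun t => P ⟨t, hTS t.2⟩, fun t => h1 _, fun s t hst => h2 _ _ fun e =>
    hst (Subtype.ext (Subtype.mk.inj e))⟩

end PathsOfLinks

/-! ### A well-ordered cost that determines the edges -/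

section Costs

/-- There are costs for the edges such that the number of edges is nondecreasing in the cost, and
such that the cost of a linkage determines its edges. -/
theorem exists_cost (V : Type u) : ∃ (Γ : Type u) (_ : AddCommMonoid Γ) (_ : LinearOrder Γ)
    (_ : IsOrderedCancelAddMonoid Γ) (_ : WellFoundedLT Γ) (c : V → V → Γ) (ℓ : Γ →+ ℕ)
    (m : V → V → Γ →+ ℕ), Monotone ℓ ∧ (∀ v w, ℓ (c v w) = 1) ∧
      ∀ v w v' w', m v w (c v' w') ≠ 0 ↔ v' = v ∧ w' = w := by
  classical
  let _ : LinearOrder (V × V) := linearOrderOfSTO WellOrderingRel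
  have : WellFoundedLT (V × V) := ⟨WellOrderingRel.isWellOrder.wf⟩
  -- The colexicographic order compares the largest index first. An edge contributes 1 at `⊤`, which
  -- thus counts edges with highest priority, and 1 at its own index, which records its identity.
  let Γ := Colex (WithTop (V × V) →₀ ℕ)
  let e : WithTop (V × V) → Γ →+ ℕ := fun i =>
    { toFun := fun x => ofColex x i, map_zero' := rfl, map_add' := fun _ _ => rfl }
  refine ⟨Γ, inferInstance, inferInstance, inferInstance, inferInstance,
    fun v w => toColex (Finsupp.single (⊤ : WithTop (V × V)) 1 +
      Finsupp.single (((v, w) : V × V) : WithTop (V × V)) 1 : WithTop (V × V) →₀ ℕ), e ⊤,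
    fun v w => e ((v, w) : V × V), ?_, ?_, ?_⟩
  · intro x y hxy
    rcases hxy.lt_or_eq with h | rfl
    · obtain ⟨i, h1, h2⟩ := Finsupp.Colex.lt_iff.1 h
      rcases eq_or_ne i ⊤ with rfl | hi
      · exact h2.le
      · exact (h1 ⊤ (lt_top_iff_ne_top.2 hi)).le
    · exact le_rfl
  · intro v w
    change (Finsupp.single (⊤ : WithTop (V × V)) 1 +
      Finsupp.single (((v, w) : V × V) : WithTop (V × V)) 1 : WithTop (V × V) →₀ ℕ) ⊤ = 1
    simp
  · intro v w v' w'
    change (Finsupp.single (⊤ : WithTop (V × V)) 1 +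
      Finsupp.single (((v', w') : V × V) : WithTop (V × V)) 1 : WithTop (V × V) →₀ ℕ)
        ((v, w) : V × V) ≠ 0 ↔ _
    simp [Finsupp.single_apply]

variable {V : Type u} {r : V → V → Prop} {B : Set V} {Γ : Type*} [AddCommMonoid Γ]
  {c : V → V → Γ}

/-- Only the step made at `v` can contribute to `m v w` of the cost, so this value detects whether
the edge is used. -/
theorem IsLink.eq_of_cost_eq {m : V → V → Γ →+ ℕ}
    (hm : ∀ v w v' w', m v w (c v' w') ≠ 0 ↔ v' = v ∧ w' = w) {f g : V → Option V} {S : Set V}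
    (hf : IsLink r B f S) (hg : IsLink r B g S) (h : cost c f = cost c g) {v w : V}
    (hv : f v = some w) (hwv : w ≠ v) : g v = some w := by
  classical
  have key : ∀ k : V → Option V, IsLink r B k S → (m v w (cost c k) ≠ 0 ↔ k v = some w) := by
    intro k hk
    unfold cost
    rw [AddMonoidHom.map_finsum _ hk.finite_support_stepCost, finsum_eq_single _ v]
    · cases e : k v with
      | none => simp [stepCost]
      | some x =>
        by_cases hx : x = v
        · subst hx
          simp [stepCost, hwv.symm]
        · simp only [stepCost, hx, if_false, hm]
          simp
    · intro u hu
      cases k u with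
      | none => simp [stepCost]
      | some x =>
        by_cases hx : x = u
        · simp [stepCost, hx]
        · simp only [stepCost, hx, if_false]
          by_contra hne
          exact hu ((hm _ _ _ _).1 hne).1
  rw [← key g hg, ← h, key f hf]
  exact hv

end Costs

/-! ### Menger's theorem, separators, and the forward direction -/

section Separation

variable {V : Type u} {r : V → V → Prop} {B : Set V}

/-- Augmenting a linkage along an alternating path. -/
theorem IsLink.augment {f : V → Option V} {T : Set V} (hf : IsLink r B f T) {w x v : V}
    (hwx : ReflTransGen (fun x y => ∃ v, f v = some x ∧ (r v y ∨ y = v)) w x)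
    (hv : f v = some x) (hvB : v ∈ B) : ∃ f', IsLink r B f' (insert w T) := by
  obtain ⟨P, hP, hPx, -⟩ := exists_finPath_of_reflTransGen hwx
  -- As a linkage of `{w}` in the auxiliary graph, the alternating path is itself a link function
  -- `h`, and the augmented linkage is `f` followed by `h`. The value `h x = v` with `f v = x` takes
  -- `v` off its path; the value `none` makes a path end at `v ∈ B`.
  have hlink : Linkable (fun x y => ∃ v, f v = some x ∧ (r v y ∨ y = v)) {w}
      {x | ∃ v ∈ B, f v = some x} :=
    ⟨fun _ => P, fun s => ⟨hP.trans s.2.symm, v, hvB, hPx ▸ hv⟩,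
      fun s t hst => (hst (Subtype.ext (s.2.trans t.2.symm))).elim⟩
  obtain ⟨h, hh⟩ := hlink.exists_isLink (Set.finite_singleton w)
  have hbind : ∀ v y, (f v).bind h = some y ↔ ∃ x, f v = some x ∧ h x = some y := fun v y =>
    Option.bind_eq_some_iff
  have hT : ∀ x ∈ T, ∀ v, f v ≠ some x := fun x hx => (hf.start x).1 hx
  refine ⟨fun v => (f v).bind h, ?_, ?_, ?_, ?_, ?_⟩
  · intro v y hy
    obtain ⟨x, h1, h2⟩ := (hbind v y).1 hy
    rcases hh.step x y h2 with rfl | ⟨v', h3, h4⟩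
    · exact hf.step v y h1
    · rw [hf.inj _ _ _ h1 h3]
      exact h4.symm
  · intro v hv
    cases e : f v with
    | none => exact hf.none v e
    | some x =>
      obtain ⟨v', h1, h2⟩ := hh.none x (by simpa [e] using hv)
      exact hf.inj _ _ _ h2 e ▸ h1
  · intro u v y hu hv
    obtain ⟨x, h1, h2⟩ := (hbind u y).1 hu
    obtain ⟨x', h3, h4⟩ := (hbind v y).1 hv
    obtain rfl := hh.inj _ _ _ h2 h4
    exact hf.inj _ _ _ h1 h3
  · intro y
    constructor
    · rintro (rfl | hy) v e
      · obtain ⟨x, -, h2⟩ := (hbind v y).1 e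
        exact (hh.start y).1 rfl x h2
      · obtain ⟨x, h1, h2⟩ := (hbind v y).1 e
        by_cases hxy : x = y
        · exact hT y hy v (hxy ▸ h1)
        · cases e' : h y with
          | none =>
            obtain ⟨v', -, h3⟩ := hh.none y e'
            exact hT y hy v' h3
          | some z =>
            rcases hh.step y z e' with rfl | ⟨v', h3, -⟩
            · exact hxy (hh.inj _ _ _ h2 e')
            · exact hT y hy v' h3
    · intro hy
      by_cases hyw : y = w
      · exact Or.inl hyw
      · right
        have : ¬ ∀ x, h x ≠ some y := fun hx => hyw ((hh.start y).2 hx)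
        push Not at this
        obtain ⟨x, hx⟩ := this
        by_cases hxT : x ∈ T
        · rcases hh.step x y hx with rfl | ⟨v', h3, -⟩
          · exact hxT
          · exact (hT x hxT v' h3).elim
        · rw [hf.start] at hxT
          push Not at hxT
          obtain ⟨v, hv⟩ := hxT
          exact (hy v ((hbind v y).2 ⟨x, hv, hx⟩)).elim
  · refine (hf.fin.union hh.fin).subset fun v hv => ?_
    by_contra hne
    simp only [Set.mem_union, Set.mem_ofPred_eq, not_or, not_not] at hne
    exact hv ((hbind v v).2 ⟨v, hne.1, hne.2⟩)

/-- Menger's theorem for a finite set `S`: if `S` cannot be linked to `B`, then `S` is separated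
from `B` by fewer than `|S|` vertices. The set `C` consists of vertices behind the separator. -/
theorem exists_separator_of_not_linkable {S : Set V} (hS : S.Finite) (h : ¬ Linkable r S B) :
    ∃ C X : Set V, X.Finite ∧ X.ncard < S.ncard ∧ S ⊆ C ∪ X ∧ (∀ v ∈ C, v ∉ B) ∧
      ∀ v ∈ C, ∀ w, r v w → w ∈ C ∪ X := by
  have hfin : {T : Set V | T ⊆ S ∧ ∃ f, IsLink r B f T}.Finite :=
    hS.finite_subsets.subset fun T hT => hT.1
  obtain ⟨T, hT⟩ := hfin.exists_maximal ⟨∅, Set.empty_subset _, some, isLink_empty r B⟩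
  obtain ⟨⟨hTS, f, hf⟩, hmax⟩ := hT
  have hne : ∃ w ∈ S, w ∉ T := by
    by_contra hcon
    push Not at hcon
    obtain rfl : T = S := hTS.antisymm hcon
    exact h hf.linkable
  obtain ⟨w₀, hw₀S, hw₀T⟩ := hne
  -- `D` is what alternating walks reach from the unlinked part of `S`. The separator will be `(D ∪
  -- T) \ C`.
  let alt : V → V → Prop := fun x y => ∃ v, f v = some x ∧ (r v y ∨ y = v)
  let D : Set V := {x | ∃ w ∈ S, w ∉ T ∧ ReflTransGen alt w x}
  let C : Set V := {v | ∃ x ∈ D, f v = some x}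
  have hDC : ∀ x ∈ D, ∀ v, f v = some x → ∀ y, (r v y ∨ y = v) → y ∈ D := by
    rintro x ⟨w, h1, h2, h3⟩ v hv y hy
    exact ⟨w, h1, h2, h3.tail ⟨v, hv, hy⟩⟩
  have hCD : C ⊆ D := fun v ⟨x, hx, hv⟩ => hDC x hx v hv v (Or.inr rfl)
  have hSD : S ⊆ D ∪ T := fun s hs => by
    by_cases hsT : s ∈ T
    · exact Or.inr hsT
    · exact Or.inl ⟨s, hs, hsT, .refl⟩
  let Y : Set V := {v | f v ≠ some v}
  have hY : Y.Finite := hf.fin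
  have hTY : T ⊆ Y := fun t ht => (hf.start t).1 ht t
  have hsucc : ∀ v ∈ Y, ∀ x, f v = some x → x ∈ Y := fun v hv x hx e =>
    hv (hf.inj _ _ _ hx e ▸ e)
  have hXY : (D ∪ T) \ C ⊆ Y := by
    rintro x ⟨hx | hx, hxC⟩
    · exact fun e => hxC ⟨x, hx, e⟩
    · exact hTY hx
  refine ⟨C, (D ∪ T) \ C, hY.subset hXY, ?_, ?_, ?_, ?_⟩
  -- `f` maps `C ∩ Y` bijectively onto `(D ∩ Y) \ T`. So removing `C` from `D ∩ Y` leaves `|D ∩ T|`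
  -- vertices, and the separator has at most `|T| < |S|`.
  · have hcard : (C ∩ Y).ncard = ((D ∩ Y) \ T).ncard := by
      refine Set.ncard_congr (fun v _ => (f v).getD v) ?_ ?_ ?_
      · rintro v ⟨⟨x, hx, hv⟩, hvY⟩
        simp only [hv, Option.getD_some]
        exact ⟨⟨hx, hsucc v hvY x hv⟩, fun hxT => (hf.start x).1 hxT v hv⟩
      · rintro u v ⟨⟨x, hx, hu⟩, -⟩ ⟨⟨y, hy, hv⟩, -⟩ e
        simp only [hu, hv, Option.getD_some] at e
        exact hf.inj _ _ _ hu (e ▸ hv)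
      · rintro y ⟨⟨hyD, hyY⟩, hyT⟩
        rw [hf.start] at hyT
        push Not at hyT
        obtain ⟨v, hv⟩ := hyT
        refine ⟨v, ⟨⟨y, hyD, hv⟩, fun e => ?_⟩, by simp [hv]⟩
        obtain rfl := Option.some_injective _ (e.symm.trans hv)
        exact hyY e
    have hTfin : T.Finite := hS.subset hTS
    have e1 : (D ∪ T) \ C = ((D ∩ Y) \ (C ∩ Y)) ∪ (T \ (D ∩ Y)) := by
      ext x
      have h1 := @hXY x
      have h2 := @hCD x
      have h3 := @hTY x
      simp only [Set.mem_sdiff, Set.mem_union, Set.mem_inter_iff] at *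
      tauto
    have e2 := Set.ncard_union_le ((D ∩ Y) \ (C ∩ Y)) (T \ (D ∩ Y))
    have e3 := Set.ncard_sdiff_add_ncard_of_subset (Set.inter_subset_inter_left Y hCD)
      (hY.subset Set.inter_subset_right)
    have e4 := Set.ncard_inter_add_ncard_sdiff_eq_ncard (D ∩ Y) T (hY.subset Set.inter_subset_right)
    have e5 := Set.ncard_inter_add_ncard_sdiff_eq_ncard T (D ∩ Y) hTfin
    have e6 : T.ncard < S.ncard :=
      Set.ncard_lt_ncard ⟨hTS, fun hle => hw₀T (hle hw₀S)⟩ hS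
    rw [Set.inter_comm T] at e5
    rw [e1]
    omega
  · intro s hs
    by_cases hsC : s ∈ C
    · exact Or.inl hsC
    · exact Or.inr ⟨hSD hs, hsC⟩
  · rintro v ⟨x, ⟨w, h1, h2, h3⟩, hv⟩ hvB
    obtain ⟨f', hf'⟩ := hf.augment h3 hv hvB
    exact h2 (hmax ⟨Set.insert_subset h1 hTS, f', hf'⟩ (Set.subset_insert w T) (Set.mem_insert w T))
  · rintro v ⟨x, hx, hv⟩ y hy
    by_cases hyC : y ∈ C
    · exact Or.inl hyC
    · exact Or.inr ⟨Or.inl (hDC x hx v hv y (Or.inl hy)), hyC⟩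

theorem ncard_le_ncard_of_disjoint {S X : Set V} (hX : X.Finite) (D : S → Set V)
    (hD : ∀ s t, s ≠ t → Disjoint (D s) (D t)) (h : ∀ s, ¬ Disjoint (D s) X) :
    S.ncard ≤ X.ncard := by
  have h' : ∀ s, ∃ x, x ∈ D s ∧ x ∈ X := fun s => Set.not_disjoint_iff.1 (h s)
  choose x hxD hxX using h'
  have := hX.to_subtype
  refine Nat.card_le_card_of_injective (fun s => (⟨x s, hxX s⟩ : X)) fun s t hst => ?_
  by_contra hne
  exact Set.disjoint_left.1 (hD s t hne) (hxD s) (Subtype.mk.inj hst ▸ hxD t)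

/-- Pigeonhole: otherwise two of the paths would share a vertex of `X`. The set `Y` is `{v}` for a
dominating vertex and empty for a ray. -/
theorem exists_disjoint_of_infinite {F : Set (FinPath r)} (hF : F.Infinite) {X Y : Set V}
    (hX : X.Finite) (hXY : Disjoint X Y)
    (hpw : F.Pairwise fun P Q => P.support ∩ Q.support ⊆ Y) : ∃ P ∈ F, Disjoint P.support X := by
  by_contra hcon
  push Not at hcon
  have h' : ∀ P ∈ F, ∃ x, x ∈ P.support ∧ x ∈ X := fun P hP => Set.not_disjoint_iff.1 (hcon P hP)
  have : Nonempty V := hF.nonempty.elim fun P _ => ⟨P.first⟩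
  choose! x hx using h'
  obtain ⟨P, hP, Q, hQ, hne, e⟩ :=
    hF.exists_ne_map_eq_of_mapsTo (f := x) (t := X) (fun P hP => (hx P hP).2) hX
  exact Set.disjoint_left.1 hXY (hx P hP).2 (hpw hP hQ hne ⟨(hx P hP).1, e ▸ (hx Q hQ).1⟩)

theorem VertexDominates.exists_disjoint {v : V} (h : VertexDominates r B v) {X : Set V}
    (hX : X.Finite) (hv : v ∉ X) :
    ∃ P : FinPath r, P.first = v ∧ P.last ∈ B ∧ Disjoint P.support X := by
  obtain ⟨F, hF, h1, h2⟩ := h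
  obtain ⟨P, hP, hd⟩ := exists_disjoint_of_infinite hF hX (Set.disjoint_singleton_right.2 hv)
    fun P hP Q hQ hne => (h2 hP hQ hne).subset
  exact ⟨P, (h1 P hP).1, (h1 P hP).2, hd⟩

theorem RayDominates.exists_disjoint {R : Ray r} (h : RayDominates r B R) {X : Set V}
    (hX : X.Finite) :
    ∃ P : FinPath r, P.first ∈ R.support ∧ P.last ∈ B ∧ Disjoint P.support X := by
  obtain ⟨F, hF, h1, h2⟩ := h
  obtain ⟨P, hP, hd⟩ := exists_disjoint_of_infinite hF hX (Set.disjoint_empty X)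
    fun P hP Q hQ hne => (Set.disjoint_iff_inter_eq_empty.1 (h2 hP hQ hne)).subset
  exact ⟨P, (h1 P hP).1, (h1 P hP).2, hd⟩

/-- If there is a domination linkage from `A` to `B`, then every finite subset of `A` can be linked
to `B`. -/
theorem IsDominationLinkage.linkable {A : Set V} {Q : A → FinPath r ⊕ Ray r}
    (hQ : IsDominationLinkage r A B Q) {S : Set V} (hSA : S ⊆ A) (hS : S.Finite) :
    Linkable r S B := by
  by_contra hcon
  obtain ⟨C, X, hX, hcard, hSC, hCB, hC⟩ := exists_separator_of_not_linkable hS hcon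
  obtain ⟨hQ1, hQ2, hQ3⟩ := hQ
  refine hcard.not_ge (ncard_le_ncard_of_disjoint hX (fun s : S => support (Q ⟨s, hSA s.2⟩))
    (fun s t hst => hQ2 _ _ fun e => hst (Subtype.ext (Subtype.mk.inj e))) fun s hd => ?_)
  have hreach : ∀ v ∈ C, ∀ w, ReflTransGen (fun x y => r x y ∧ y ∉ X) v w → w ∈ C := by
    intro v hv w h
    induction h with
    | refl => exact hv
    | tail _ h ih => exact (hC _ ih _ h.1).resolve_right h.2
  have hs : start (Q ⟨s, hSA s.2⟩) ∈ C := by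
    rw [hQ1]
    have hmem := start_mem_support (Q ⟨s, hSA s.2⟩)
    rw [hQ1] at hmem
    exact (hSC s.2).resolve_right (Set.disjoint_left.1 hd hmem)
  have hB : ∀ P : FinPath r, P.first ∈ C → P.last ∈ B → Disjoint P.support X → False :=
    fun P h1 h2 h3 => hCB _ (hreach _ h1 _ (P.reach_avoiding h3 P.last_mem_support).1) h2
  have hdom := hQ3 ⟨s, hSA s.2⟩
  cases e : Q ⟨s, hSA s.2⟩ with
  | inl P =>
    rw [e] at hd hs hdom
    rcases hdom with h | h
    · exact hB P hs h hd
    · obtain ⟨P', h1, h2, h3⟩ := h.exists_disjoint hX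
        (Set.disjoint_left.1 hd P.last_mem_support)
      exact hB P' (h1 ▸ hreach _ hs _ (P.reach_avoiding hd P.last_mem_support).1) h2 h3
  | inr R =>
    rw [e] at hd hs hdom
    obtain ⟨P', ⟨n, hn⟩, h2, h3⟩ := RayDominates.exists_disjoint hdom hX
    refine hB P' ?_ h2 h3
    rw [← hn]
    refine hreach _ hs _ ?_
    clear hn
    induction n with
    | zero => exact .refl
    | succ n ih => exact ih.tail ⟨R.adj n, Set.disjoint_left.1 hd ⟨n + 1, rfl⟩⟩

/-- Zorn's lemma gives a maximal family. It serves to build finite separators: the vertices of a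
maximal family of disjoint paths meet every further path. -/
theorem exists_finite_maximal_pairwise {α : Type*} {ρ : α → α → Prop} {K : Set α}
    (hρ : ∀ a b, ρ a b → ρ b a) (h : ∀ F ⊆ K, F.Pairwise ρ → F.Finite) :
    ∃ F ⊆ K, F.Finite ∧ ∀ a ∈ K, a ∈ F ∨ ∃ b ∈ F, ¬ ρ a b := by
  obtain ⟨F, hF⟩ := zorn_subset {F | F ⊆ K ∧ F.Pairwise ρ} fun c hc hchain =>
    ⟨⋃₀ c, ⟨Set.sUnion_subset fun F hF => (hc hF).1,
      (Set.pairwise_sUnion hchain.directedOn).2 fun F hF => (hc hF).2⟩,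
      fun F hF => Set.subset_sUnion_of_mem hF⟩
  refine ⟨F, hF.prop.1, h F hF.prop.1 hF.prop.2, fun a ha => ?_⟩
  by_contra hcon
  push Not at hcon
  refine hcon.1 (hF.le_of_ge ⟨Set.insert_subset ha hF.prop.1, ?_⟩ (Set.subset_insert a F)
    (Set.mem_insert a F))
  exact hF.prop.2.insert fun b hb _ => ⟨hcon.2 b hb, hρ _ _ (hcon.2 b hb)⟩

theorem exists_separator_of_not_vertexDominates {v : V} (hv : v ∉ B)
    (h : ¬ VertexDominates r B v) : ∃ X : Set V, X.Finite ∧ v ∉ X ∧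
      ∀ P : FinPath r, P.first = v → P.last ∈ B → ¬ Disjoint P.support X := by
  obtain ⟨F, hFK, hF, hmax⟩ := exists_finite_maximal_pairwise
    (ρ := fun P Q : FinPath r => P.support ∩ Q.support = {v})
    (K := {P : FinPath r | P.first = v ∧ P.last ∈ B})
    (fun P Q h => by rwa [Set.inter_comm]) fun F hFK hpw => by
      by_contra hinf
      exact h ⟨F, hinf, hFK, hpw⟩
  refine ⟨(⋃ P ∈ F, P.support) \ {v}, (hF.biUnion fun P _ => P.finite_support).sdiff, by simp,
    fun P h1 h2 hd => ?_⟩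
  have key : ∀ Q ∈ F, ∀ x ∈ P.support, x ∈ Q.support → x = v := by
    intro Q hQ x hx hxQ
    by_contra hne
    exact Set.disjoint_left.1 hd hx ⟨Set.mem_biUnion hQ hxQ, hne⟩
  rcases hmax P ⟨h1, h2⟩ with hP | ⟨Q, hQ, hne⟩
  -- A member of the family that misses the separator is trivial, which `v ∉ B` excludes.
  · exact hv (key P hP _ P.last_mem_support P.last_mem_support ▸ h2)
  · refine hne (Set.eq_singleton_iff_unique_mem.2 ⟨⟨?_, ?_⟩, fun x hx => key Q hQ x hx.1 hx.2⟩)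
    · exact h1 ▸ P.first_mem_support
    · exact (hFK hQ).1 ▸ Q.first_mem_support

theorem exists_separator_of_not_rayDominates {R : Ray r} (h : ¬ RayDominates r B R) :
    ∃ X : Set V, X.Finite ∧
      ∀ P : FinPath r, P.first ∈ R.support → P.last ∈ B → ¬ Disjoint P.support X := by
  obtain ⟨F, hFK, hF, hmax⟩ := exists_finite_maximal_pairwise
    (ρ := fun P Q : FinPath r => Disjoint P.support Q.support)
    (K := {P : FinPath r | P.first ∈ R.support ∧ P.last ∈ B})
    (fun P Q h => h.symm) fun F hFK hpw => by
      by_contra hinf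
      exact h ⟨F, hinf, hFK, hpw⟩
  refine ⟨⋃ P ∈ F, P.support, hF.biUnion fun P _ => P.finite_support, fun P h1 h2 hd => ?_⟩
  rcases hmax P ⟨h1, h2⟩ with hP | ⟨Q, hQ, hne⟩
  · exact Set.disjoint_left.1 hd P.first_mem_support (Set.mem_biUnion hP P.first_mem_support)
  · exact hne (hd.mono_right (Set.subset_biUnion_of_mem (u := fun P : FinPath r => P.support) hQ))

end Separation

theorem exists_forall_le_of_bounded {α : Type*} {p : α → Prop} {k : α → ℕ} {N : ℕ}
    (hne : ∃ a, p a) (hN : ∀ a, p a → k a ≤ N) : ∃ a, p a ∧ ∀ b, p b → k b ≤ k a := by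
  obtain ⟨a, ha, hmin⟩ := (measure fun a => N - k a).wf.has_min {a | p a} hne
  refine ⟨a, ha, fun b hb => ?_⟩
  have h1 : ¬ N - k b < N - k a := hmin b hb
  have h2 := hN b hb
  omega

/-! ### Cheapest linkages: finitely many continuations, bounded pursuit of a ray -/

section Minimal

variable {V : Type u} {r : V → V → Prop} {B : Set V} {Γ : Type*} [AddCommMonoid Γ] [LinearOrder Γ]
  {c : V → V → Γ}

variable (c) in
/-- A link function of minimal cost. -/
def IsMinLink (r : V → V → Prop) (B : Set V) (f : V → Option V) (S : Set V) : Prop :=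
  IsLink r B f S ∧ ∀ g, IsLink r B g S → cost c f ≤ cost c g

theorem Linkable.exists_isMinLink [WellFoundedLT Γ] {S : Set V} (hS : S.Finite)
    (h : Linkable r S B) : ∃ f, IsMinLink c r B f S := by
  obtain ⟨f, hf⟩ := h.exists_isLink hS
  obtain ⟨g, hg, hmin⟩ := (InvImage.wf (cost c) (wellFounded_lt (α := Γ))).has_min
    {f | IsLink r B f S} ⟨f, hf⟩
  exact ⟨g, hg, fun g' hg' => not_lt.1 (hmin g' hg')⟩

/-- If a vertex `p n` neither lies in `B` nor dominates `B`, then all minimal linkages of which a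
path starts with `p 0, …, p n` continue this path to one of finitely many vertices. -/
theorem exists_finite_successors [IsOrderedCancelAddMonoid Γ] [WellFoundedLT Γ]
    {m : V → V → Γ →+ ℕ} (hm : ∀ v w v' w', m v w (c v' w') ≠ 0 ↔ v' = v ∧ w' = w)
    {p : ℕ → V} {n : ℕ} (hinj : Set.InjOn p (Set.Iic n)) (hr : ∀ i < n, r (p i) (p (i + 1)))
    (hB : p n ∉ B) (hdom : ¬ VertexDominates r B (p n)) :
    ∃ W : Set V, W.Finite ∧ ∀ S f, IsMinLink c r B f S → p 0 ∈ S →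
      (∀ i < n, f (p i) = some (p (i + 1))) → ∀ w, f (p n) = some w → w ∈ W := by
  classical
  obtain ⟨X, hX, hvX, hsep⟩ := exists_separator_of_not_vertexDominates hB hdom
  -- Linkages that start in out-neighbours of `p n` and avoid `p 0, …, p n`. Prefixing `p n` to one
  -- of their paths gives a connection to `B` that must meet `X`, which bounds their number of
  -- paths.
  let K : Set V × (V → Option V) → Prop := fun q =>
    IsLink r B q.2 q.1 ∧ (∀ w ∈ q.1, r (p n) w) ∧ ∀ i ≤ n, q.2 (p i) = some (p i)
  have hKbd : ∀ q, K q → q.1.ncard ≤ X.ncard := by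
    rintro ⟨W, g⟩ ⟨h1, h2, h3⟩
    obtain ⟨P, hP1, hP2, hP3⟩ := h1.exists_finPath
    refine ncard_le_ncard_of_disjoint hX (fun w => (P w).support) hP2 fun w hd => ?_
    have hreach := ((P w).reach_avoiding hd (P w).last_mem_support).1
    have hw : (P w).first ∉ X := Set.disjoint_left.1 hd (P w).first_mem_support
    rw [(hP1 w).1] at hw hreach
    obtain ⟨P', h4, h5, h6⟩ := exists_finPath_avoiding hvX (hreach.head ⟨h2 w w.2, hw⟩)
    exact hsep P' h4 (h5 ▸ (hP1 w).2) h6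
  obtain ⟨⟨W', g'⟩, hK', hmax⟩ := exists_forall_le_of_bounded (p := K)
    (k := fun q => q.1.ncard)
    ⟨(∅, some), isLink_empty r B, by simp, by simp⟩ hKbd
  -- Among the largest linkages take a cheapest one, counting also the edges from `p n` to its first
  -- vertices. These first vertices form the desired finite set.
  obtain ⟨⟨W, g⟩, ⟨⟨hg, hWr, hgfix⟩, hcard⟩, hmin⟩ :=
    (InvImage.wf (fun q : Set V × (V → Option V) => cost c q.2 + ∑ᶠ u ∈ q.1, c (p n) u)
      (wellFounded_lt (α := Γ))).has_min {q | K q ∧ q.1.ncard = W'.ncard} ⟨(W', g'), hK', rfl⟩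
  replace hmin : ∀ q, K q → q.1.ncard = W'.ncard →
      cost c g + ∑ᶠ u ∈ W, c (p n) u ≤ cost c q.2 + ∑ᶠ u ∈ q.1, c (p n) u :=
    fun q h h' => not_lt.1 (hmin q ⟨h, h'⟩)
  dsimp only at hg hWr hgfix hcard hmax
  refine ⟨W, hg.finite, fun S f hf hpS hstep w hw => ?_⟩
  by_contra hwW
  have hlt : ∀ i < n, p n ≠ p i := fun i hi e => by
    have := hinj (show n ∈ Set.Iic n by simp) (show i ∈ Set.Iic n from hi.le) e
    omega
  have hnS : p n ∉ S \ {p 0} := by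
    rintro ⟨hS, h0⟩
    cases n with
    | zero => exact h0 rfl
    | succ n => exact (hf.1.start _).1 hS _ (hstep n (by omega))
  have hwS : w ∉ S := fun h => (hf.1.start w).1 h _ hw
  obtain ⟨f₁, hf₁, hcost₁, hfix₁, hoff₁⟩ := hf.1.cut_segment (c := c) hpS hstep hinj
  have hf₁n : f₁ (p n) = some w := (hoff₁ _ hlt).trans hw
  obtain ⟨hf₀, hcost₀⟩ := hf₁.cut (c := c) (Set.mem_insert _ _) hf₁n
  rw [Set.insert_sdiff_self_of_notMem hnS] at hf₀
  set f₀ := Function.update f₁ (p n) (some (p n)) with hf₀def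
  have hfix₀ : ∀ i ≤ n, f₀ (p i) = some (p i) := by
    intro i hi
    rcases hi.lt_or_eq with h | rfl
    · rw [hf₀def, Function.update_of_ne (hlt i h).symm, hfix₁ i h]
    · simp [hf₀def]
  have hwn : w ≠ p n := fun e =>
    (hf₀.start w).1 (Or.inl rfl) (p n) (by rw [hfix₀ n le_rfl, e])
  have hrw : r (p n) w := (hf.1.step _ _ hw).resolve_left hwn
  have hwT : w ∉ S \ {p 0} := fun h => hwS h.1
  -- `f₀` is `f` without the segment from `p 0` to `w`. Exchanging at `w` either enlarges `W`,
  -- against maximality, or trades `w` for some `u ∈ W`.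
  obtain ⟨f₂, g₂, hswap, h⟩ := hf₀.exchange hg (Set.mem_insert _ _) hwW
  have hfixf : ∀ i ≤ n, f₂ (p i) = some (p i) := fun i hi => by
    rcases hswap (p i) with ⟨e, -⟩ | ⟨e, -⟩
    exacts [e.trans (hfix₀ i hi), e.trans (hgfix i hi)]
  have hfixg : ∀ i ≤ n, g₂ (p i) = some (p i) := fun i hi => by
    rcases hswap (p i) with ⟨-, e⟩ | ⟨-, e⟩
    exacts [e.trans (hgfix i hi), e.trans (hfix₀ i hi)]
  rcases h with hg₂ | ⟨u, huW, huT, hf₂, hg₂⟩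
  · have := hmax (insert w W, g₂) ⟨hg₂, Set.forall_mem_insert.2 ⟨hrw, hWr⟩, hfixg⟩
    rw [Set.ncard_insert_of_notMem hwW hg.finite, hcard] at this
    omega
  · rw [Set.insert_sdiff_self_of_notMem hwT] at hf₂
    have hwWu : w ∉ W \ {u} := fun h => hwW h.1
    have hWeq : insert u (W \ {u}) = W := Set.insert_sdiff_self_of_mem huW
    have huWu : u ∉ W \ {u} := fun h => h.2 rfl
    have hfinWu : (W \ {u}).Finite := hg.finite.sdiff
    have hle := hmin (insert w (W \ {u}), g₂)
      ⟨hg₂, Set.forall_mem_insert.2 ⟨hrw, fun x hx => hWr x hx.1⟩, hfixg⟩ (by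
        rw [← hcard, ← hWeq, Set.ncard_insert_of_notMem (by simpa using hwWu) (by simpa using hfinWu),
          Set.ncard_insert_of_notMem huWu hfinWu]
        simp)
    have hsumW : ∑ᶠ x ∈ W, c (p n) x = c (p n) u + ∑ᶠ x ∈ W \ {u}, c (p n) x := by
      rw [← finsum_mem_insert _ huWu hfinWu, hWeq]
    dsimp only at hle
    rw [hsumW, finsum_mem_insert _ hwWu hfinWu] at hle
    have hsw := hswap.cost_add_cost (c := c) hf₀ hg hf₂ hg₂
    -- The exchange preserves total cost and `g₂` competes with `g`, so continuing to `u` costs no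
    -- more than continuing to `w`.
    have hle' : cost c f₂ + c (p n) u ≤ cost c f₀ + c (p n) w := by
      refine le_of_add_le_add_right
        (a := cost c g + cost c g₂ + ∑ᶠ x ∈ W \ {u}, c (p n) x) ?_
      calc cost c f₂ + c (p n) u + (cost c g + cost c g₂ + ∑ᶠ x ∈ W \ {u}, c (p n) x)
          = (cost c f₂ + cost c g₂) + (cost c g + (c (p n) u + ∑ᶠ x ∈ W \ {u}, c (p n) x)) := by
            abel
        _ ≤ (cost c f₀ + cost c g) + (cost c g₂ + (c (p n) w + ∑ᶠ x ∈ W \ {u}, c (p n) x)) := by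
            rw [hsw]
            gcongr
        _ = _ := by abel
    obtain ⟨hf₃, hcost₃⟩ := hf₂.extend (c := c) (fun h => huT (Or.inr h)) (hfixf n le_rfl)
      (hWr u huW)
    obtain ⟨f₄, hf₄, hcost₄, -, hoff₄⟩ := hf₃.extend_segment (c := c) hnS
      (fun i hi => by rw [Function.update_of_ne (hlt i hi).symm, hfixf i hi.le]) hr hinj
    have hun : u ≠ p n := fun e => (hg.start u).1 huW (p n) (by rw [hgfix n le_rfl, e])
    have hf₄n : f₄ (p n) = some u := by rw [hoff₄ _ hlt, Function.update_self]
    rw [Set.insert_sdiff_self_of_mem hpS] at hf₄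
    have heq : cost c f₄ = cost c f := by
      refine le_antisymm ?_ (hf.2 f₄ hf₄)
      rw [hcost₄, hcost₃, hcost₁, hcost₀]
      gcongr
    -- Equal cost means equal edges, so `f` itself continues from `p n` to `u`.
    have := hf₄.eq_of_cost_eq hm hf.1 heq hf₄n hun
    rw [hw] at this
    exact hwW (Option.some_injective _ this ▸ huW)

/-- Cut at the last vertex in `Z`: no later step enters `Z`. -/
theorem FinPath.exists_suffix (P : FinPath r) {Z : Set V} (h : P.first ∈ Z) :
    ∃ P' : FinPath (fun v w => r v w ∧ w ∉ Z),
      P'.first ∈ Z ∧ P'.last = P.last ∧ P'.support ⊆ P.support := by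
  classical
  obtain ⟨p, n, adj, inj, h0, hn, hs⟩ := P.exists_seq
  let k := Nat.findGreatest (fun i => p i ∈ Z) n
  have hkn : k ≤ n := Nat.findGreatest_le n
  have hkZ : p k ∈ Z := Nat.findGreatest_spec (P := fun i => p i ∈ Z) n.zero_le (h0 ▸ h)
  have hgt : ∀ i, k < i → i ≤ n → p i ∉ Z := fun i h1 h2 =>
    Nat.findGreatest_is_greatest (P := fun i => p i ∈ Z) h1 h2
  have inj' : Set.InjOn (fun j => p (k + j)) (Set.Iic (n - k)) := by
    intro j hj l hl h
    simp only [Set.mem_Iic] at hj hl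
    have := inj (show k + j ∈ Set.Iic n by simp; omega) (show k + l ∈ Set.Iic n by simp; omega) h
    omega
  refine ⟨.ofSeq (fun j => p (k + j)) (n - k) (fun j hj => ⟨adj _ (by omega), hgt _ ?_ ?_⟩) inj',
    ?_, ?_, ?_⟩
  · omega
  · omega
  · rw [FinPath.first_ofSeq]
    exact hkZ
  · rw [FinPath.last_ofSeq, hn, Nat.add_sub_cancel' hkn]
  · rw [FinPath.support_ofSeq, hs]
    rintro _ ⟨j, hj, rfl⟩
    simp only [Set.mem_Iic] at hj
    exact ⟨k + j, by simp; omega, rfl⟩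

/-- A linkable subset of `Z` can be replaced by one of the same size that is linked by paths
meeting `Z` only in their first vertices. -/
theorem Linkable.exists_avoiding {W Z : Set V} (hW : W.Finite) (hWZ : W ⊆ Z)
    (h : Linkable r W B) : ∃ W' ⊆ Z, W'.Finite ∧ W'.ncard = W.ncard ∧
      Linkable (fun v w => r v w ∧ w ∉ Z) W' B := by
  obtain ⟨P, h1, h2⟩ := h
  choose P' hP1 hP2 hP3 using fun w => (P w).exists_suffix (Z := Z) ((h1 w).1 ▸ hWZ w.2)
  have hdisj : ∀ s t, s ≠ t → Disjoint (P' s).support (P' t).support := fun s t hst =>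
    (h2 s t hst).mono (hP3 s) (hP3 t)
  have hinj : Function.Injective fun w => (P' w).first := by
    intro s t hst
    by_contra hne
    refine Set.disjoint_left.1 (hdisj s t hne) (P' s).first_mem_support ?_
    rw [show (P' s).first = (P' t).first from hst]
    exact (P' t).first_mem_support
  have := hW.to_subtype
  refine ⟨Set.range fun w => (P' w).first, ?_, Set.finite_range _, ?_, ?_⟩
  · rintro _ ⟨w, rfl⟩
    exact hP1 w
  · exact Nat.card_range_of_injective hinj
  · choose k hk using fun s : Set.range fun w => (P' w).first => s.2
    refine ⟨fun s => P' (k s), fun s => ⟨hk s, hP2 (k s) ▸ (h1 _).2⟩, fun s t hst => hdisj _ _ ?_⟩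
    exact fun e => hst (Subtype.ext ((hk s).symm.trans (e ▸ hk t)))

/-- If a ray does not dominate `B`, then no path of a minimal linkage follows it for long. -/
theorem exists_bound_of_not_rayDominates [IsOrderedCancelAddMonoid Γ] {ℓ : Γ →+ ℕ}
    (hℓ : Monotone ℓ) (hℓc : ∀ v w, ℓ (c v w) = 1) {R : Ray r} (hdom : ¬ RayDominates r B R) :
    ∃ M, ∀ S f n, IsMinLink c r B f S → R.seq 0 ∈ S →
      (∀ i < n, f (R.seq i) = some (R.seq (i + 1))) → n ≤ M := by
  obtain ⟨X, hX, hsep⟩ := exists_separator_of_not_rayDominates hdom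
  obtain ⟨W', ⟨hW'R, g', hg'⟩, hmax⟩ := exists_forall_le_of_bounded
    (p := fun W : Set V => W ⊆ R.support ∧ ∃ g, IsLink r B g W) (k := fun W => W.ncard)
    (N := X.ncard) ⟨∅, Set.empty_subset _, some, isLink_empty r B⟩ (by
      rintro W ⟨h1, g, h2⟩
      obtain ⟨P, hP1, hP2, -⟩ := h2.exists_finPath
      refine ncard_le_ncard_of_disjoint hX (fun w => (P w).support) hP2 fun w hd => ?_
      exact hsep (P w) ((hP1 w).1 ▸ h1 w.2) (hP1 w).2 hd)
  obtain ⟨W, hWR, hW, hcard, hlink⟩ := hg'.linkable.exists_avoiding hg'.finite hW'R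
  obtain ⟨g, hg⟩ := hlink.exists_isLink hW
  have hgr : IsLink r B g W := hg.mono fun _ _ h => h.1
  obtain ⟨N, hN⟩ := (hW.preimage R.inj.injOn).bddAbove
  -- Rerouting along `g` adds at most `ℓ (cost c g)` edges, and the new path follows at most `N`
  -- edges of `R` to reach `W`. Following `R` for longer would therefore not be cheapest.
  refine ⟨N + ℓ (cost c g), fun S f n hf h0 hstep => ?_⟩
  by_contra! hn
  obtain ⟨f₀, hf₀, hcost₀, hfix₀, -⟩ := hf.1.cut_segment (c := c) h0 hstep R.inj.injOn
  have hnW : R.seq n ∉ W := fun h => by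
    have := hN (show n ∈ R.seq ⁻¹' W from h)
    omega
  have hS : ∀ i < n, R.seq (i + 1) ∉ S := fun i hi h => (hf.1.start _).1 h _ (hstep i hi)
  have hT : ∀ i ≤ n, R.seq i ∉ S \ {R.seq 0} := by
    rintro i hi ⟨h1, h2⟩
    cases i with
    | zero => exact h2 rfl
    | succ i => exact hS i hi h1
  obtain ⟨f₁, g₁, hswap, h⟩ := hf₀.exchange hgr (Set.mem_insert _ _) hnW
  rcases h with hg₁ | ⟨u, huW, huT, hf₁, hg₁⟩
  · have := hmax (insert (R.seq n) W) ⟨Set.insert_subset ⟨n, rfl⟩ hWR, g₁, hg₁⟩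
    rw [Set.ncard_insert_of_notMem hnW hW, hcard] at this
    omega
  · rw [Set.insert_sdiff_self_of_notMem (hT n le_rfl)] at hf₁
    obtain ⟨j, rfl⟩ := hWR huW
    have hj : j ≤ N := hN huW
    -- Such a vertex is no start of `f₁`, so it has a predecessor. Under `f₀` that is the vertex
    -- itself, since the segment was cut away; under `g` likewise, since no edge of `g` enters `R`.
    have hfix₁ : ∀ i < j, f₁ (R.seq i) = some (R.seq i) := by
      intro i hi
      have hi' : R.seq i ∉ insert (R.seq j) (S \ {R.seq 0}) := by
        rintro (h | h)
        · exact hi.ne (R.inj h)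
        · exact hT i (by omega) h
      rw [hf₁.start] at hi'
      push Not at hi'
      obtain ⟨v, hv⟩ := hi'
      have : v = R.seq i := by
        rcases hswap v with ⟨e, -⟩ | ⟨e, -⟩ <;> rw [e] at hv
        · exact hf₀.inj _ _ _ hv (hfix₀ i (by omega))
        · rcases hg.step _ _ hv with h | h
          · exact h.symm
          · exact (h.2 ⟨i, rfl⟩).elim
      rwa [this] at hv
    obtain ⟨f₂, hf₂, hcost₂, -⟩ := hf₁.extend_segment (c := c) (fun h => huT (Or.inr h)) hfix₁
      (fun i _ => R.adj i) R.inj.injOn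
    rw [Set.insert_sdiff_self_of_mem h0] at hf₂
    have h1 := hℓ (hf.2 f₂ hf₂)
    have h2 := congrArg ℓ (hswap.cost_add_cost (c := c) hf₀ hgr hf₁ hg₁)
    rw [hcost₂, hcost₀] at h1
    simp only [map_add, map_sum, hℓc, Finset.sum_const, Finset.card_range, smul_eq_mul,
      mul_one] at h1 h2
    omega

end Minimal

/-! ### The limit of cheapest linkages along an ultrafilter -/

section Main

variable {V : Type u} {r : V → V → Prop} {A B : Set V}

/-- A path or ray for a relation is one for every weaker relation. -/
def weaken {s : V → V → Prop} (h : ∀ v w, r v w → s v w) :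
    FinPath r ⊕ Ray r → FinPath s ⊕ Ray s :=
  Sum.map (FinPath.mono h) fun R => ⟨R.seq, fun n => h _ _ (R.adj n), R.inj⟩

theorem start_weaken {s : V → V → Prop} (h : ∀ v w, r v w → s v w) (Q : FinPath r ⊕ Ray r) :
    start (weaken h Q) = start Q := by
  cases Q <;> rfl

theorem support_weaken {s : V → V → Prop} (h : ∀ v w, r v w → s v w) (Q : FinPath r ⊕ Ray r) :
    support (weaken h Q) = support Q := by
  cases Q <;> rfl

/-- If every finite subset of `A` can be linked to `B`, then there is a domination linkage from `A`
to `B`. -/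
theorem exists_isDominationLinkage (h : ∀ S : Set V, S ⊆ A → S.Finite → Linkable r S B) :
    ∃ Q, IsDominationLinkage r A B Q := by
  classical
  obtain ⟨Γ, _, _, _, _, c, ℓ, m, hℓ, hℓc, hm⟩ := exists_cost V
  let S : Finset A → Set V := fun s => Subtype.val '' (s : Set A)
  have hmin : ∀ s, ∃ f, IsMinLink c r B f (S s) := fun s =>
    (h (S s) (by rintro _ ⟨a, -, rfl⟩; exact a.2)
      (s.finite_toSet.image _)).exists_isMinLink (s.finite_toSet.image _)
  choose f hf using hmin
  -- It refines `atTop`, so each `a` belongs to almost all of the finite sets.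
  let U : Ultrafilter (Finset A) := Ultrafilter.of atTop
  have hU : ∀ a : A, ∀ᶠ s in (U : Filter (Finset A)), (a : V) ∈ S s := fun a =>
    Ultrafilter.of_le atTop ((eventually_ge_atTop {a}).mono fun s hs =>
      ⟨a, Finset.singleton_subset_iff.1 hs, rfl⟩)
  let L : V → V → Prop := fun v w => ∀ᶠ s in (U : Filter (Finset A)), f s v = some w ∧ w ≠ v
  have hl : ∀ u v w, L u w → L v w → u = v := fun u v w hu hv => by
    obtain ⟨s, h1, h2⟩ := (hu.and hv).exists
    exact (hf s).1.inj _ _ _ h1.1 h2.1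
  have hs : ∀ a : A, ∀ v, ¬ L v a := fun a v hv => by
    obtain ⟨s, h1, h2⟩ := (hv.and (hU a)).exists
    exact ((hf s).1.start a).1 h2 v h1.1
  have hLr : ∀ v w, L v w → r v w := fun v w hvw => by
    obtain ⟨s, h1, h2⟩ := hvw.exists
    exact ((hf s).1.step _ _ h1).resolve_left h2
  have hseg : ∀ (p : ℕ → V) (n : ℕ), (∀ i < n, L (p i) (p (i + 1))) →
      ∀ᶠ s in (U : Filter (Finset A)), ∀ i < n, f s (p i) = some (p (i + 1)) := by
    intro p n hp
    refine (Set.finite_Iio n).eventually_all.2 fun i hi => (hp i hi).mono fun s hs => hs.1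
  choose Q hQ1 hQ2 using fun a : A => exists_maximal_path_or_ray hl (hs a)
  refine ⟨fun a => weaken hLr (Q a), fun a => ?_, fun a b hab => ?_, fun a => ?_⟩
  · rw [start_weaken, hQ1]
  · rw [support_weaken, support_weaken]
    refine disjoint_support_of_leftUnique hl (hQ1 a ▸ hs a) (hQ1 b ▸ hs b) ?_
    rw [hQ1, hQ1]
    exact fun e => hab (Subtype.ext e)
  · have h1 := hQ1 a
    have h2 := hQ2 a
    change EndsInOrDominates r B (weaken hLr (Q a))
    cases e : Q a with
    | inl P =>
      rw [e] at h1
      change P.last ∈ B ∨ VertexDominates r B P.last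
      by_contra hcon
      rw [not_or] at hcon
      obtain ⟨p, n, adj, inj, hp0, hpn, -⟩ := P.exists_seq
      have ha : p 0 = a := hp0.symm.trans h1
      rw [hpn] at hcon
      obtain ⟨W, hW, hWmem⟩ := exists_finite_successors (c := c) hm inj
        (fun i hi => hLr _ _ (adj i hi)) hcon.1 hcon.2
      have hev : ∀ᶠ s in (U : Filter (Finset A)), ∃ w ∈ W, f s (p n) = some w ∧ w ≠ p n := by
        filter_upwards [hU a, hseg p n adj] with s hsa hsp
        rw [← ha] at hsa
        cases e' : f s (p n) with
        | none => exact (hcon.1 ((hf s).1.none _ e')).elim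
        | some w =>
          refine ⟨w, hWmem _ _ (hf s) hsa hsp w e', rfl, ?_⟩
          -- A fixed `p n` is impossible: it is either a start or already the value of `f s` at its
          -- predecessor on the path.
          rintro rfl
          cases n with
          | zero => exact ((hf s).1.start _).1 hsa _ e'
          | succ n =>
            have := inj (show n ∈ Set.Iic (n + 1) by simp) (show n + 1 ∈ Set.Iic (n + 1) by simp)
              ((hf s).1.inj _ _ _ (hsp n (by omega)) e')
            omega
      -- Of finitely many continuations, an ultrafilter selects one; the maximal path could thus be
      -- continued.
      obtain ⟨w, -, hw⟩ := (Ultrafilter.eventually_exists_mem_iff hW).1 hev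
      exact h2 P e w (hpn ▸ hw)
    | inr R =>
      rw [e] at h1
      change RayDominates r B _
      by_contra hcon
      obtain ⟨M, hM⟩ := exists_bound_of_not_rayDominates (c := c) hℓ hℓc hcon
      obtain ⟨s, h3, h4⟩ := ((hU a).and (hseg R.seq (M + 1) fun i _ => R.adj i)).exists
      have h0 : R.seq 0 = a := h1
      have := hM _ _ (M + 1) (hf s) (h0.symm ▸ h3) h4
      omega

end Main

/-! ### The closure of a vertex set among vertices and ends -/

section Topology

variable {V : Type u} {G : SimpleGraph V} {B : Set V}

theorem mem_component_of_reach {X : Set V} {C : G.ComponentCompl X} {v w : V} (hv : v ∈ C)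
    (h : ReflTransGen (fun x y => G.Adj x y ∧ y ∉ X) v w) : w ∈ C := by
  induction h with
  | refl => exact hv
  | tail _ h ih => exact SimpleGraph.ComponentCompl.mem_of_adj _ _ ih h.2 h.1

theorem reach_of_mem_component {X : Set V} {C : G.ComponentCompl X} {v w : V} (hv : v ∈ C)
    (hw : w ∈ C) : ReflTransGen (fun x y => G.Adj x y ∧ y ∉ X) v w := by
  obtain ⟨h1, e1⟩ := hv
  obtain ⟨h2, e2⟩ := hw
  obtain ⟨p⟩ := SimpleGraph.ConnectedComponent.eq.1 (e1.trans e2.symm)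
  have key : ∀ a b : (Xᶜ : Set V), (G.induce Xᶜ).Walk a b →
      ReflTransGen (fun x y => G.Adj x y ∧ y ∉ X) (a : V) b := by
    intro a b q
    induction q with
    | nil => exact .refl
    | @cons a b c hab _ ih => exact .head ⟨hab, b.2⟩ ih
  exact key _ _ p

theorem component_subset {X X' : Set V} (hX : X' ⊆ X) {C : G.ComponentCompl X}
    {C' : G.ComponentCompl X'} {v : V} (hv : v ∈ C) (hv' : v ∈ C') : (C : Set V) ⊆ C' :=
  fun _ hw => mem_component_of_reach hv' <|
    ReflTransGen.mono (fun _ _ h => ⟨h.1, fun hx => h.2 (hX hx)⟩) _ _ (reach_of_mem_component hv hw)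

/-- The ray obtained by deleting the first `n` vertices of a ray. -/
def Ray.drop {r : V → V → Prop} (R : Ray r) (n : ℕ) : Ray r where
  seq i := R.seq (n + i)
  adj i := R.adj (n + i)
  inj i j h := by
    have := R.inj h
    omega

theorem endOf_drop (R : Ray G.Adj) (n : ℕ) : endOf G (R.drop n) = endOf G R := by
  refine Quotient.sound fun X => ?_
  obtain ⟨C, hC⟩ := exists_hasTailIn G R X
  refine ⟨C, ?_, hC⟩
  obtain ⟨N, hN⟩ := eventually_atTop.1 hC
  exact eventually_atTop.2 ⟨N, fun i hi => hN _ (by omega)⟩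

theorem ofVertex_mem_basicOpen {X : Finset V} {C : G.ComponentCompl (X : Set V)} {v : V} :
    ofVertex G v ∈ basicOpen G C ↔ v ∈ C := by
  constructor
  · rintro (⟨w, hw, e⟩ | ⟨ω, -, e⟩)
    · exact Sum.inl_injective e ▸ hw
    · cases e
  · exact fun h => Or.inl ⟨v, h, rfl⟩

/-- A tail of `R` is an equivalent ray, and equivalent rays have tails in the same component. So a
condition on some ray of the end can be tested on any representative. -/
theorem ofEnd_mem_basicOpen {X : Finset V} {C : G.ComponentCompl (X : Set V)} {R : Ray G.Adj} :
    ofEnd G (endOf G R) ∈ basicOpen G C ↔ HasTailIn G R C := by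
  constructor
  · rintro (⟨w, hw, e⟩ | ⟨ω, ⟨R', hR', hC⟩, e⟩)
    · cases e
    · obtain rfl := Sum.inr_injective e
      obtain ⟨C', h1, h2⟩ := Quotient.exact hR' X
      obtain rfl := hasTailIn_unique G h1 (Eventually.of_forall fun n => hC ⟨n, rfl⟩)
      exact h2
  · intro h
    obtain ⟨N, hN⟩ := eventually_atTop.1 h
    refine Or.inr ⟨_, ⟨R.drop N, endOf_drop R N, ?_⟩, rfl⟩
    rintro _ ⟨i, rfl⟩
    exact hN _ (by omega)

/-- Inside basic sets for `X₁` and `X₂`, the component of `G - (X₁ ∪ X₂)` belonging to the given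
point provides a common refinement. -/
theorem isTopologicalBasis_basicOpen (G : SimpleGraph V) :
    TopologicalSpace.IsTopologicalBasis
      {U | ∃ (X : Finset V) (C : G.ComponentCompl (X : Set V)), U = basicOpen G C} := by
  classical
  refine ⟨?_, ?_, rfl⟩
  · rintro _ ⟨X₁, C₁, rfl⟩ _ ⟨X₂, C₂, rfl⟩ x ⟨h1, h2⟩
    have key : ∀ C : G.ComponentCompl ((X₁ ∪ X₂ : Finset V) : Set V), ∀ v, v ∈ C → v ∈ C₁ →
        v ∈ C₂ → basicOpen G C ⊆ basicOpen G C₁ ∩ basicOpen G C₂ := by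
      intro C v hC hC₁ hC₂
      have s1 := component_subset (by simp) hC hC₁
      have s2 := component_subset (by simp) hC hC₂
      have mono : ∀ {X' : Finset V} {C' : G.ComponentCompl (X' : Set V)}, (C : Set V) ⊆ C' →
          basicOpen G C ⊆ basicOpen G C' := fun hs =>
        Set.union_subset_union (Set.image_mono hs)
          (Set.image_mono fun ω ⟨R, e, h⟩ => ⟨R, e, h.trans hs⟩)
      exact Set.subset_inter (mono s1) (mono s2)
    rcases x with v | ω
    · have h1 := ofVertex_mem_basicOpen.1 h1
      have h2 := ofVertex_mem_basicOpen.1 h2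
      have hv : v ∉ ((X₁ ∪ X₂ : Finset V) : Set V) := by
        have := SimpleGraph.ComponentCompl.notMem_of_mem h1
        have := SimpleGraph.ComponentCompl.notMem_of_mem h2
        simp_all
      exact ⟨_, ⟨_, G.componentComplMk hv, rfl⟩,
        ofVertex_mem_basicOpen.2 (G.componentComplMk_mem hv),
        key _ v (G.componentComplMk_mem hv) h1 h2⟩
    · obtain ⟨R, rfl⟩ := Quotient.exists_rep ω
      have h1 := ofEnd_mem_basicOpen.1 h1
      have h2 := ofEnd_mem_basicOpen.1 h2
      obtain ⟨C, hC⟩ := exists_hasTailIn G R (X₁ ∪ X₂)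
      obtain ⟨n, ⟨hn, hn1⟩, hn2⟩ := ((hC.and h1).and h2).exists
      exact ⟨_, ⟨_, C, rfl⟩, ofEnd_mem_basicOpen.2 hC, key C _ hn hn1 hn2⟩
  · refine Set.eq_univ_of_forall fun x => ?_
    rcases x with v | ω
    · have hv : v ∉ ((∅ : Finset V) : Set V) := by simp
      exact ⟨_, ⟨_, G.componentComplMk hv, rfl⟩,
        ofVertex_mem_basicOpen.2 (G.componentComplMk_mem hv)⟩
    · obtain ⟨R, rfl⟩ := Quotient.exists_rep ω
      obtain ⟨C, hC⟩ := exists_hasTailIn G R ∅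
      exact ⟨_, ⟨_, C, rfl⟩, ofEnd_mem_basicOpen.2 hC⟩

theorem mem_vertexClosure_iff {x : VertexEndSpace G} :
    x ∈ vertexClosure G B ↔ ∀ (X : Finset V) (C : G.ComponentCompl (X : Set V)),
      x ∈ basicOpen G C → ∃ b ∈ B, b ∈ C := by
  rw [vertexClosure, (isTopologicalBasis_basicOpen G).mem_closure_iff]
  constructor
  · intro h X C hx
    obtain ⟨_, h1, b, hb, rfl⟩ := h _ ⟨X, C, rfl⟩ hx
    exact ⟨b, hb, ofVertex_mem_basicOpen.1 h1⟩
  · rintro h _ ⟨X, C, rfl⟩ hx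
    obtain ⟨b, hb, hbC⟩ := h X C hx
    exact ⟨_, ofVertex_mem_basicOpen.2 hbC, b, hb, rfl⟩

theorem last_mem_component {X : Set V} {C : G.ComponentCompl X} {P : FinPath G.Adj}
    (hP : Disjoint P.support X) (hC : P.first ∈ C) : P.last ∈ C :=
  mem_component_of_reach hC (P.reach_avoiding hP P.last_mem_support).1

theorem exists_finPath_in_component {X : Set V} {C : G.ComponentCompl X} {v w : V} (hv : v ∈ C)
    (hw : w ∈ C) : ∃ P : FinPath G.Adj, P.first = v ∧ P.last = w ∧ Disjoint P.support X :=
  exists_finPath_avoiding (SimpleGraph.ComponentCompl.notMem_of_mem hv)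
    (reach_of_mem_component hv hw)

theorem ofVertex_mem_vertexClosure {v : V} :
    ofVertex G v ∈ vertexClosure G B ↔ v ∈ B ∨ VertexDominates G.Adj B v := by
  constructor
  · intro h
    by_contra hcon
    rw [not_or] at hcon
    obtain ⟨X, hX, hvX, hsep⟩ := exists_separator_of_not_vertexDominates hcon.1 hcon.2
    lift X to Finset V using hX
    obtain ⟨b, hb, hbC⟩ := mem_vertexClosure_iff.1 h X (G.componentComplMk hvX)
      (ofVertex_mem_basicOpen.2 (G.componentComplMk_mem hvX))
    obtain ⟨P, h1, h2, h3⟩ := exists_finPath_in_component (G.componentComplMk_mem hvX) hbC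
    exact hsep P h1 (h2 ▸ hb) h3
  · rintro (h | h)
    · exact subset_closure ⟨v, h, rfl⟩
    · refine mem_vertexClosure_iff.2 fun X C hv => ?_
      have hv := ofVertex_mem_basicOpen.1 hv
      obtain ⟨P, h1, h2, h3⟩ :=
        h.exists_disjoint X.finite_toSet (SimpleGraph.ComponentCompl.notMem_of_mem hv)
      exact ⟨P.last, h2, last_mem_component h3 (h1.symm ▸ hv)⟩

/-- The left side depends only on the end, so either all rays of an end dominate `B` or none does.
-/
theorem ofEnd_mem_vertexClosure {R : Ray G.Adj} :
    ofEnd G (endOf G R) ∈ vertexClosure G B ↔ RayDominates G.Adj B R := by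
  constructor
  · intro h
    by_contra hcon
    obtain ⟨X, hX, hsep⟩ := exists_separator_of_not_rayDominates hcon
    lift X to Finset V using hX
    obtain ⟨C, hC⟩ := exists_hasTailIn G R X
    obtain ⟨b, hb, hbC⟩ := mem_vertexClosure_iff.1 h X C (ofEnd_mem_basicOpen.2 hC)
    obtain ⟨n, hn⟩ := hC.exists
    obtain ⟨P, h1, h2, h3⟩ := exists_finPath_in_component hn hbC
    exact hsep P (h1 ▸ ⟨n, rfl⟩) (h2 ▸ hb) h3
  · intro h
    refine mem_vertexClosure_iff.2 fun X C hC => ?_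
    obtain ⟨N, hN⟩ := eventually_atTop.1 (ofEnd_mem_basicOpen.1 hC)
    -- Avoiding also the first `N` vertices of `R` forces the path to start in the tail of `R`
    -- inside `C`.
    obtain ⟨P, ⟨n, hn⟩, h2, h3⟩ :=
      h.exists_disjoint (X.finite_toSet.union ((Set.finite_Iio N).image R.seq))
    rw [Set.disjoint_union_right] at h3
    have hNn : N ≤ n := by
      by_contra! hlt
      exact Set.disjoint_left.1 h3.2 P.first_mem_support ⟨n, hlt, hn⟩
    exact ⟨P.last, h2, last_mem_component h3.1 (hn ▸ hN n hNn)⟩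

theorem terminus_mem_vertexClosure {Q : FinPath G.Adj ⊕ Ray G.Adj} :
    terminus G Q ∈ vertexClosure G B ↔ EndsInOrDominates G.Adj B Q := by
  cases Q with
  | inl P => exact ofVertex_mem_vertexClosure
  | inr R => exact ofEnd_mem_vertexClosure

theorem linkableToClosure_iff {A : Set V} :
    LinkableToClosure G A B ↔ ∃ Q, IsDominationLinkage G.Adj A B Q := by
  simp only [LinkableToClosure, IsDominationLinkage, terminus_mem_vertexClosure]

theorem vertexClosure_eq (G : SimpleGraph V) (B : Set V) :
    vertexClosure G B = ofVertex G '' (B ∪ {v | VertexDominates G.Adj B v}) ∪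
      ofEnd G '' {ω | ∀ R : Ray G.Adj, endOf G R = ω → RayDominates G.Adj B R} := by
  ext x
  constructor
  · intro hx
    rcases x with v | ω
    · exact Or.inl ⟨v, ofVertex_mem_vertexClosure.1 hx, rfl⟩
    · exact Or.inr ⟨ω, fun R hR => ofEnd_mem_vertexClosure.1 (hR ▸ hx), rfl⟩
  · rintro (⟨v, hv, rfl⟩ | ⟨ω, hω, rfl⟩)
    · exact ofVertex_mem_vertexClosure.2 hv
    · obtain ⟨R, rfl⟩ := Quotient.exists_rep ω
      exact ofEnd_mem_vertexClosure.2 (hω R rfl)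

end Topology

theorem exists_isDominationLinkage_iff {V : Type u} {r : V → V → Prop} {A B : Set V} :
    (∃ Q, IsDominationLinkage r A B Q) ↔ ∀ S : Set V, S ⊆ A → S.Finite → Linkable r S B :=
  ⟨fun ⟨_, hQ⟩ _ hSA hS => hQ.linkable hSA hS, exists_isDominationLinkage⟩

end DomLink

theorem theorem1p3 :
    -- (i) digraphs
    (∀ (V : Type u) (G : Digraph V) (A B : Set V),
      (∃ Q, DomLink.IsDominationLinkage G.Adj A B Q) ↔
        ∀ S : Set V, S ⊆ A → S.Finite → DomLink.Linkable G.Adj S B) ∧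
    -- (ii) undirected graphs
    (∀ (V : Type u) (G : SimpleGraph V) (A B : Set V),
      (DomLink.LinkableToClosure G A B ↔
        ∀ S : Set V, S ⊆ A → S.Finite → DomLink.Linkable G.Adj S B) ∧
      ((∃ Q, DomLink.IsDominationLinkage G.Adj A B Q) ↔
        ∀ S : Set V, S ⊆ A → S.Finite → DomLink.Linkable G.Adj S B) ∧
      -- the closure of `B`: `B`, the vertices dominating `B`, the ends whose rays dominate `B`
      DomLink.vertexClosure G B =
        DomLink.ofVertex G '' (B ∪ {v | DomLink.VertexDominates G.Adj B v}) ∪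
        DomLink.ofEnd G '' {ω | ∀ R : DomLink.Ray G.Adj,
          DomLink.endOf G R = ω → DomLink.RayDominates G.Adj B R}) := by
  exact ⟨fun V G A B => DomLink.exists_isDominationLinkage_iff, fun V G A B =>
    ⟨DomLink.linkableToClosure_iff.trans DomLink.exists_isDominationLinkage_iff,
      DomLink.exists_isDominationLinkage_iff, DomLink.vertexClosure_eq G B⟩⟩
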